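/- **Setting.** Let $\mathbb{A}=\{x\in\mathbb{R}^3 : x_1+x_2+x_3=0\}$ be the Euclidean plane, and let $W_{\mathrm{aff}}=W\ltimes\mathbb{R}^2$ be the group of all affine isometries of $\mathbb{A}$ whose linear part is a permutation of the coordinates ($W\cong\mathfrak{S}_3$ is the Weyl group of type $A_2$). The *walls* are the lines $\{x_i-x_j=c\}$ ($i\ne j$, $c\in\mathbb{R}$), i.e. the fixed lines of elements of $W_{\mathrm{aff}}$; an *open half apartment* is a connected component of the complement of a wall. The *vectorial facets* are the classes of vectors lying in the same walls through $0$ and in the same open half apartments bounded by walls through $0$: the origin, six open rays (the *vectorial panels*) and six open cones (the *Weyl chambers*). For $x\in\mathbb{A}$ and a vectorial facet $F$, the *facet* $\sigma_{F,x}$ is the filter of all subsets of $\mathbb{A}$ that contain a finite intersection of walls and open half apartments which itself contains $U\cap(x+F)$ for some neighbourhood $U$ of $x$. An *affine building of type $A_2$* is a set $\mathcal{B}$ with a collection $\mathcal{F}$ of filters on $\mathcal{B}$ (the facets) and a collection $\mathcal{A}$ of subsets of $\mathcal{B}$ (the apartments), each apartment $A$ endowed with a metric $d_A$, such that, writing $\mathcal{F}_A=\{\sigma\in\mathcal{F}: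 A\in\sigma\}$ for the set of facets contained in $A$: * (B0) for every $A\in\mathcal{A}$ there is a *chart* $f:\mathbb{A}\to A$, that is, an isometry onto $(A,d_A)$ that carries the set of facets $\sigma_{F,x}$ of $\mathbb{A}$ onto $\mathcal{F}_A$; * (B1) any two facets are contained in a common apartment; * (B2) if $A,A'\in\mathcal{A}$, then $A\cap A'$ is a union of facets (each $p\in A\cap A'$ belongs to all the sets of some facet $\sigma$ with $A\cap A'\in\sigma$), and for any two facets $\sigma,\sigma'$ contained in $A\cap A'$ there is an isometry $A\to A'$ carrying $\mathcal{F}_A$ onto $\mathcal{F}_{A'}$ and fixing pointwise the closure of some set of $\sigma$ and the closure of some set of $\sigma'$ (closures taken in $A$). It has a *complete system of apartments* if there is no affine building $(\mathcal{B},\mathcal{F},\mathcal{A}')$ of type $A_2$ with $\mathcal{A}\subsetneq\mathcal{A}'$ (with the same metrics on the members of $\mathcal{A}$). A *sector based at $x\in\mathcal{B}$* is a set $S=f(v+\overline{C})$, where $f$ is a chart of an apartment, $f(v)=x$, and $C$ is a Weyl chamber; its *faces* are the two rays $f(v+\overline{F})$, where $F\subset\overline{C}$ is a vectorial panel. **Statement.**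 Let $\mathcal{B}$ be an affine building of type $A_2$ with a complete system of apartments, let $x\in\mathcal{B}$, and let $S_1,S_2,S_3,S_4$ be sectors based at $x$. Suppose that for $i=1,2,3$ the intersection $P_i=S_i\cap S_{i+1}$ is a face of both $S_i$ and $S_{i+1}$, and that $P_1\neq P_2$ and $P_2\neq P_3$. Then there is an apartment $A\in\mathcal{A}$ with $S_1\cup S_2\cup S_3\cup S_4\subseteq A$. -/

import Mathlib

open scoped Topology Pointwise

namespace AffBuilding

/-! ### Affine Coxeter complexes -/

/-- A nonempty affine subspace of codimension one. -/
def IsAffineHyperplane {V : Type*} [NormedAddCommGroup V] [InnerProductSpace ℝ V]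
    (H : AffineSubspace ℝ V) : Prop :=
  (H : Set V).Nonempty ∧ Module.finrank ℝ H.direction + 1 = Module.finrank ℝ V

/-- The walls of a group `W` of affine isometries: the affine hyperplanes that are the fixed point
set of an element of `W`. -/
def walls {V : Type*} [NormedAddCommGroup V] [InnerProductSpace ℝ V]
    (W : Subgroup (V ≃ᵃⁱ[ℝ] V)) : Set (AffineSubspace ℝ V) :=
  {H | IsAffineHyperplane H ∧ ∃ w ∈ W, ∀ x : V, w x = x ↔ x ∈ H}

/-- The vectorial walls: the directions of the walls, seen as hyperplanes through the origin. -/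
def vectorWalls {V : Type*} [NormedAddCommGroup V] [InnerProductSpace ℝ V]
    (W : Subgroup (V ≃ᵃⁱ[ℝ] V)) : Set (AffineSubspace ℝ V) :=
  {U | ∃ H ∈ walls W, U = H.direction.toAffineSubspace}

/-- For a family of hyperplanes (the walls), the collection consisting of all the walls and of all
the open half apartments. An open half apartment, i.e. a connected component of the complement of a
wall `H`, is the set of points strictly on the same side of `H` as a given point off `H`. -/
def wallsAndOpenHalves {V : Type*} [NormedAddCommGroup V] [InnerProductSpace ℝ V]
    (Hs : Set (AffineSubspace ℝ V)) : Set (Set V) :=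
  {D | ∃ H ∈ Hs, D = (H : Set V) ∨ ∃ z, z ∉ H ∧ D = {y | H.SSameSide z y}}

/-- Vectorial facets: classes of vectors lying in the same vectorial walls and in the same open
vectorial half apartments. -/
def IsVectorFacet {V : Type*} [NormedAddCommGroup V] [InnerProductSpace ℝ V]
    (W : Subgroup (V ≃ᵃⁱ[ℝ] V)) (F : Set V) : Prop :=
  ∃ v : V, F = {u | ∀ D ∈ wallsAndOpenHalves (vectorWalls W), u ∈ D ↔ v ∈ D}

/-- Weyl chambers: vectorial facets that are maximal for the face relation `F ⊆ closure F'`. -/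
def IsWeylChamber {V : Type*} [NormedAddCommGroup V] [InnerProductSpace ℝ V]
    (W : Subgroup (V ≃ᵃⁱ[ℝ] V)) (C : Set V) : Prop :=
  IsVectorFacet W C ∧ ∀ F, IsVectorFacet W F → C ⊆ closure F → F = C

/-- Vectorial panels: vectorial facets whose support, the intersection of the vectorial walls
containing them, has codimension one. -/
def IsVectorPanel {V : Type*} [NormedAddCommGroup V] [InnerProductSpace ℝ V]
    (W : Subgroup (V ≃ᵃⁱ[ℝ] V)) (F : Set V) : Prop :=
  IsVectorFacet W F ∧
    IsAffineHyperplane (sInf {U : AffineSubspace ℝ V | U ∈ vectorWalls W ∧ F ⊆ (U : Set V)})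

/-- The facet with base point `x` and direction `F`: the filter of all sets containing a finite
intersection of walls and open half apartments which itself contains `U ∩ (x + F)` for some
neighbourhood `U` of `x`. -/
def facetFilter {V : Type*} [NormedAddCommGroup V] [InnerProductSpace ℝ V]
    (W : Subgroup (V ≃ᵃⁱ[ℝ] V)) (x : V) (F : Set V) : Filter V where
  sets := {Z | ∃ Ds : Set (Set V), Ds.Finite ∧ Ds ⊆ wallsAndOpenHalves (walls W) ∧
    (∃ U ∈ 𝓝 x, U ∩ (x +ᵥ F) ⊆ ⋂₀ Ds) ∧ ⋂₀ Ds ⊆ Z}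
  univ_sets := ⟨∅, Set.finite_empty, Set.empty_subset _, ⟨Set.univ, Filter.univ_mem, by simp⟩,
    Set.subset_univ _⟩
  sets_of_superset := by
    rintro Y Z ⟨Ds, h1, h2, h3, h4⟩ hYZ
    exact ⟨Ds, h1, h2, h3, h4.trans hYZ⟩
  inter_sets := by
    rintro Y Z ⟨Ds, h1, h2, ⟨U, hU, h3⟩, h4⟩ ⟨Es, k1, k2, ⟨U', hU', k3⟩, k4⟩
    refine ⟨Ds ∪ Es, h1.union k1, Set.union_subset h2 k2,
      ⟨U ∩ U', Filter.inter_mem hU hU', ?_⟩, ?_⟩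
    · rw [Set.sInter_union]
      exact fun y hy => ⟨h3 ⟨hy.1.1, hy.2⟩, k3 ⟨hy.1.2, hy.2⟩⟩
    · rw [Set.sInter_union]
      exact Set.inter_subset_inter h4 k4

/-- The facets of the Euclidean apartment attached to `W`. -/
def modelFacets {V : Type*} [NormedAddCommGroup V] [InnerProductSpace ℝ V]
    (W : Subgroup (V ≃ᵃⁱ[ℝ] V)) : Set (Filter V) :=
  {σ | ∃ x F, IsVectorFacet W F ∧ σ = facetFilter W x F}

/-! ### Affine buildings -/

/-- The data underlying a building on the set `X`: a collection of filters (the facets), and a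
collection of subsets (the apartments), each of them endowed with a distance function `dA A`;
only the values of `dA A` on points of an apartment `A` matter. -/
structure BuildingData (X : Type*) where
  /-- the facets -/
  facets : Set (Filter X)
  /-- the apartments -/
  apartments : Set (Set X)
  /-- the distance function of each apartment -/
  dA : Set X → X → X → ℝ

/-- The facets contained in the subset `A`. -/
def BuildingData.facetsIn {X : Type*} (B : BuildingData X) (A : Set X) : Set (Filter X) :=
  {σ | σ ∈ B.facets ∧ A ∈ σ}

/-- The closure of `Z` in the apartment `A`. -/
def BuildingData.closureIn {X : Type*} (B : BuildingData X) (A Z : Set X) : Set X :=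
  {p | p ∈ A ∧ ∀ ε > 0, ∃ q ∈ Z ∩ A, B.dA A p q < ε}

/-- `f` is an isomorphism of the Euclidean apartment attached to `W` onto the apartment `A`:
an isometry onto `A` that carries the facets of the model exactly to the facets in `A`. -/
def BuildingData.IsChart {X : Type*} (B : BuildingData X)
    {V : Type*} [NormedAddCommGroup V] [InnerProductSpace ℝ V] (W : Subgroup (V ≃ᵃⁱ[ℝ] V))
    (A : Set X) (f : V → X) : Prop :=
  Function.Injective f ∧ Set.range f = A ∧ (∀ u v : V, B.dA A (f u) (f v) = dist u v) ∧
    Filter.map f '' modelFacets W = B.facetsIn A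

/-- `φ` restricts to an isometry of the apartment `A` onto the apartment `A'` which carries the
facets in `A` to the facets in `A'`. -/
def BuildingData.IsApartmentIso {X : Type*} (B : BuildingData X) (A A' : Set X) (φ : X → X) :
    Prop :=
  Set.BijOn φ A A' ∧ (∀ p ∈ A, ∀ q ∈ A, B.dA A' (φ p) (φ q) = B.dA A p q) ∧
    Filter.map φ '' B.facetsIn A = B.facetsIn A'

/-- `φ` fixes pointwise the closure, in the apartment `A`, of the filter `σ`: it fixes every point
of the closure of some set of `σ`. -/
def BuildingData.FixesClosure {X : Type*} (B : BuildingData X) (A : Set X) (φ : X → X)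
    (σ : Filter X) : Prop :=
  ∃ Z ∈ σ, ∀ p ∈ B.closureIn A Z, φ p = p

/-- Affine buildings modelled on the affine Coxeter complex `(V, W)`. -/
structure IsAffineBuilding {V : Type*} [NormedAddCommGroup V] [InnerProductSpace ℝ V]
    (W : Subgroup (V ≃ᵃⁱ[ℝ] V)) {X : Type*} (B : BuildingData X) : Prop where
  /-- every apartment is isomorphic to the Euclidean apartment attached to `W` -/
  exists_chart : ∀ A ∈ B.apartments, ∃ f : V → X, B.IsChart W A f
  /-- two facets lie in a common apartment (which then contains their closures taken in it) -/
  exists_apartment : ∀ σ ∈ B.facets, ∀ τ ∈ B.facets, ∃ A ∈ B.apartments, A ∈ σ ∧ A ∈ τ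
  /-- the intersection of two apartments is a union of facets -/
  inter_union_facets : ∀ A ∈ B.apartments, ∀ A' ∈ B.apartments, ∀ p ∈ A ∩ A',
    ∃ σ ∈ B.facetsIn (A ∩ A'), pure p ≤ σ
  /-- given two facets in the intersection of two apartments, there is an isomorphism between
  these apartments that fixes the closures of both facets pointwise -/
  exists_iso : ∀ A ∈ B.apartments, ∀ A' ∈ B.apartments,
    ∀ σ ∈ B.facetsIn (A ∩ A'), ∀ τ ∈ B.facetsIn (A ∩ A'),
      ∃ φ : X → X, B.IsApartmentIso A A' φ ∧ B.FixesClosure A φ σ ∧ B.FixesClosure A φ τ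

/-- `B` has a complete system of apartments: no building with the same facets has a strictly
larger system of apartments (with the same distances on the apartments of `B`). -/
def HasCompleteApartments {V : Type*} [NormedAddCommGroup V] [InnerProductSpace ℝ V]
    (W : Subgroup (V ≃ᵃⁱ[ℝ] V)) {X : Type*} (B : BuildingData X) : Prop :=
  ∀ B' : BuildingData X, IsAffineBuilding W B' → B'.facets = B.facets →
    B.apartments ⊆ B'.apartments →
    (∀ A ∈ B.apartments, ∀ p ∈ A, ∀ q ∈ A, B'.dA A p q = B.dA A p q) →
    B'.apartments = B.apartments

/-- `S` is a (closed) sector based at `x`: the image of `v + closure C`, for a Weyl chamber `C`,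
under a chart of some apartment which sends `v` to `x`. -/
def IsSectorAt {V : Type*} [NormedAddCommGroup V] [InnerProductSpace ℝ V]
    (W : Subgroup (V ≃ᵃⁱ[ℝ] V)) {X : Type*} (B : BuildingData X) (x : X) (S : Set X) : Prop :=
  ∃ A ∈ B.apartments, ∃ f : V → X, B.IsChart W A f ∧ ∃ v C, f v = x ∧ IsWeylChamber W C ∧
    S = f '' (v +ᵥ closure C)

/-- `S` is a (closed) sector based at `x` and `P` is a (closed) face of codimension one of `S`
with the same base point. -/
def IsFaceOfSectorAt {V : Type*} [NormedAddCommGroup V] [InnerProductSpace ℝ V]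
    (W : Subgroup (V ≃ᵃⁱ[ℝ] V)) {X : Type*} (B : BuildingData X) (x : X) (S P : Set X) : Prop :=
  ∃ A ∈ B.apartments, ∃ f : V → X, B.IsChart W A f ∧ ∃ v C F, f v = x ∧ IsWeylChamber W C ∧
    S = f '' (v +ᵥ closure C) ∧
    IsVectorPanel W F ∧ F ⊆ closure C ∧ P = f '' (v +ᵥ closure F)

/-! ### Type `A₂` -/

/-- The Euclidean plane of vectors of `ℝ³` with coordinate sum zero. -/
def planeA2 : Submodule ℝ (EuclideanSpace ℝ (Fin 3)) where
  carrier := {x | ∑ i, x i = 0}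
  zero_mem' := by simp
  add_mem' := by
    intro x y hx hy
    have hx' : ∑ i, x i = 0 := hx
    have hy' : ∑ i, y i = 0 := hy
    simp [Finset.sum_add_distrib, hx', hy']
  smul_mem' := by
    intro c x hx
    have hx' : ∑ i, x i = 0 := hx
    simp [← Finset.mul_sum, hx']

/-- The affine Weyl group `W ⋉ ℝ²`, where `W` is the Weyl group of type `A₂`, i.e. the symmetric
group permuting the three coordinates: all affine isometries of the plane whose linear part is a
permutation of the coordinates. -/
def weylA2 : Subgroup (planeA2 ≃ᵃⁱ[ℝ] planeA2) where
  carrier := {g | ∃ τ : Equiv.Perm (Fin 3), ∀ (v : planeA2) (i : Fin 3),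
    (g.linearIsometryEquiv v : EuclideanSpace ℝ (Fin 3)) i
      = (v : EuclideanSpace ℝ (Fin 3)) (τ i)}
  one_mem' := ⟨1, fun _ _ => rfl⟩
  mul_mem' := by
    rintro g h ⟨τ, hτ⟩ ⟨ρ, hρ⟩
    refine ⟨ρ * τ, fun v i => ?_⟩
    have h1 := hτ (h.linearIsometryEquiv v) i
    rw [hρ] at h1
    exact h1
  inv_mem' := by
    rintro g ⟨τ, hτ⟩
    refine ⟨τ⁻¹, fun v i => ?_⟩
    have h1 := hτ (g.linearIsometryEquiv.symm v) (τ.symm i)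
    rw [LinearIsometryEquiv.apply_symm_apply, Equiv.apply_symm_apply] at h1
    exact h1.symm

end AffBuilding

namespace AffBuilding

/-! ### Coordinates on the plane of type `A₂` -/

/-! At `x` the four sectors form a gallery whose successive panels are distinct. In type `A₂` the
chambers of an apartment around a point form a hexagon, so a gallery of four chambers without
backtracking joins opposite chambers: the germs of the first and last sectors at `x` are opposite in
some apartment (`exists_opposite`). It remains to put two opposite sectors in one apartment and to
show that this apartment contains the two sectors in between.

The tools are metric. The retraction onto an apartment centred at a chamber germ is isometric near
the origin of every germ of segment, hence does not increase distances
(`planeNorm_sub_le_of_agreeAt`). With a well chosen centre this forces a point between two points of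
an apartment to lie on their segment (`eq_of_between`), so intersections of apartments are convex.
Since an apartment containing a facet contains its closure near the base point, convexity improves:
two points in chamber position span a whole parallelogram of the intersection
(`parallelogram_subset_range`).

For opposite sectors, retracting from the germ of one of them shows that symmetric points are at
distance twice their distance to `x`. In any apartment containing both points, `x` is therefore
their midpoint (`middle_eq_of_opposite`), and this apartment contains the parallelograms from `x` to
these points. The resulting charts on larger and larger squares are compatible and glue to a map
which is a chart on each bounded set (`exists_union_chart`). Adding its image to the apartments
again gives a building, so completeness makes it an apartment (`IsLocalChart.range_mem_apartments`).

This apartment contains the panels bounding the union of the two middle sectors. Around any point of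
their common panel other than `x`, four chambers of that union form again a gallery without
backtracking, so the point is the midpoint of two points of the outer panels and lies in the
apartment (`apply_axis_mem_range`). Convexity then fills the two middle sectors.

Everything is computed in coordinates along the two edges of a chamber: this chamber is the open
positive quadrant and the walls are the level sets of `z.1`, `z.2` and `z.1 + z.2`. -/

/-- The linear forms on `ℝ × ℝ` whose level sets are the walls. -/
noncomputable def ell (i : Fin 3) : ℝ × ℝ →ₗ[ℝ] ℝ :=
  ![LinearMap.fst ℝ ℝ ℝ, LinearMap.snd ℝ ℝ ℝ, LinearMap.fst ℝ ℝ ℝ + LinearMap.snd ℝ ℝ ℝ] i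

@[simp] theorem ell_zero (z : ℝ × ℝ) : ell 0 z = z.1 := rfl
@[simp] theorem ell_one (z : ℝ × ℝ) : ell 1 z = z.2 := rfl
@[simp] theorem ell_two (z : ℝ × ℝ) : ell 2 z = z.1 + z.2 := rfl

/-- Coordinates on the plane for which the walls are the level sets of the forms `ell i`. -/
noncomputable def coordA2 : (ℝ × ℝ) ≃ₗ[ℝ] planeA2 where
  toFun z := ⟨!₂[2 * z.1 + z.2, z.2 - z.1, - z.1 - 2 * z.2], by
    change ∑ i : Fin 3, _ = (0 : ℝ)
    simp [Fin.sum_univ_three]; ring⟩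
  map_add' z w := by
    ext i; fin_cases i <;> simp <;> ring
  map_smul' c z := by
    ext i; fin_cases i <;> simp <;> ring
  invFun x := (((x : EuclideanSpace ℝ (Fin 3)) 0 - (x : EuclideanSpace ℝ (Fin 3)) 1) / 3,
    ((x : EuclideanSpace ℝ (Fin 3)) 1 - (x : EuclideanSpace ℝ (Fin 3)) 2) / 3)
  left_inv z := by
    ext <;> simp <;> ring
  right_inv x := by
    have hx : ∑ i, (x : EuclideanSpace ℝ (Fin 3)) i = 0 := x.2
    rw [Fin.sum_univ_three] at hx
    ext i; fin_cases i <;> simp <;> linarith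

theorem coordA2_symm_apply (x : planeA2) : coordA2.symm x =
    (((x : EuclideanSpace ℝ (Fin 3)) 0 - (x : EuclideanSpace ℝ (Fin 3)) 1) / 3,
    ((x : EuclideanSpace ℝ (Fin 3)) 1 - (x : EuclideanSpace ℝ (Fin 3)) 2) / 3) := rfl

/-- The Euclidean length in coordinates. -/
noncomputable def planeNorm (z : ℝ × ℝ) : ℝ := ‖coordA2 z‖

theorem planeNorm_sq (z : ℝ × ℝ) : planeNorm z ^ 2 = 6 * (z.1 ^ 2 + z.1 * z.2 + z.2 ^ 2) := by
  have : planeNorm z = ‖(coordA2 z : EuclideanSpace ℝ (Fin 3))‖ := rfl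
  rw [this, EuclideanSpace.norm_sq_eq, Fin.sum_univ_three]
  simp [coordA2]; ring

theorem planeNorm_nonneg (z : ℝ × ℝ) : 0 ≤ planeNorm z := norm_nonneg _

theorem planeNorm_zero : planeNorm 0 = 0 := by simp [planeNorm]

theorem planeNorm_eq_zero {z : ℝ × ℝ} : planeNorm z = 0 ↔ z = 0 := by simp [planeNorm]

theorem planeNorm_add_le (z w : ℝ × ℝ) : planeNorm (z + w) ≤ planeNorm z + planeNorm w := by
  simpa [planeNorm] using norm_add_le (coordA2 z) (coordA2 w)

theorem planeNorm_neg (z : ℝ × ℝ) : planeNorm (-z) = planeNorm z := by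
  simp [planeNorm]

theorem planeNorm_sub_comm (z w : ℝ × ℝ) : planeNorm (z - w) = planeNorm (w - z) := by
  rw [← planeNorm_neg, neg_sub]

theorem planeNorm_smul {r : ℝ} (hr : 0 ≤ r) (z : ℝ × ℝ) :
    planeNorm (r • z) = r * planeNorm z := by
  simp [planeNorm, norm_smul, abs_of_nonneg hr]

theorem planeNorm_eq_iff {z w : ℝ × ℝ} : planeNorm z = planeNorm w ↔
    z.1 ^ 2 + z.1 * z.2 + z.2 ^ 2 = w.1 ^ 2 + w.1 * w.2 + w.2 ^ 2 := by
  rw [← pow_left_inj₀ (planeNorm_nonneg z) (planeNorm_nonneg w) two_ne_zero, planeNorm_sq,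
    planeNorm_sq]
  constructor <;> intro h <;> linarith

theorem dist_coordA2 (z w : ℝ × ℝ) : dist (coordA2 z) (coordA2 w) = planeNorm (z - w) := by
  rw [dist_eq_norm, ← map_sub]; rfl

theorem continuous_coordA2 : Continuous coordA2 :=
  LinearMap.continuous_of_finiteDimensional coordA2.toLinearMap

theorem continuous_coordA2_symm : Continuous coordA2.symm :=
  LinearMap.continuous_of_finiteDimensional coordA2.symm.toLinearMap

theorem continuous_planeNorm : Continuous planeNorm := continuous_coordA2.norm

/-- Coordinates as a homeomorphism. -/
noncomputable def coordHomeo : (ℝ × ℝ) ≃ₜ planeA2 where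
  toEquiv := coordA2.toEquiv
  continuous_toFun := continuous_coordA2
  continuous_invFun := continuous_coordA2_symm

theorem nhds_hasBasis_planeNorm (u : ℝ × ℝ) :
    (𝓝 u).HasBasis (fun ε : ℝ => 0 < ε) fun ε => {z | planeNorm (z - u) < ε} := by
  have h := coordHomeo.isInducing.nhds_eq_comap u
  rw [h]
  have h2 := (Metric.nhds_basis_ball (x := coordHomeo u)).comap coordHomeo
  refine h2.congr (fun _ => Iff.rfl) fun ε _ => ?_
  ext z
  exact ⟨fun hz => by rw [Set.mem_preimage, Metric.mem_ball] at hz; exact (dist_coordA2 z u).symm.trans_lt hz,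
    fun hz => by rw [Set.mem_preimage, Metric.mem_ball]; exact (dist_coordA2 z u).trans_lt hz⟩

/-- Strict convexity of the Euclidean norm, from the identity `|m - r v|² = (1 - r)|m|² + r|v - m|²
- r(1 - r)|v|²`: the two bounds make the right side nonpositive. -/
theorem planeNorm_convexity {m v : ℝ × ℝ} {r : ℝ} (hr : 0 ≤ r) (hr1 : r ≤ 1)
    (h1 : planeNorm m ≤ r * planeNorm v) (h2 : planeNorm (v - m) ≤ (1 - r) * planeNorm v) :
    m = r • v := by
  have k1 := pow_le_pow_left₀ (planeNorm_nonneg _) h1 2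
  have k2 := pow_le_pow_left₀ (planeNorm_nonneg _) h2 2
  rw [mul_pow, planeNorm_sq, planeNorm_sq] at k1 k2
  have k3 : planeNorm (m - r • v) ^ 2 ≤ 0 := by
    rw [planeNorm_sq]
    simp only [Prod.fst_sub, Prod.snd_sub, Prod.smul_fst, Prod.smul_snd, smul_eq_mul] at *
    nlinarith [mul_le_mul_of_nonneg_left k1 (sub_nonneg.2 hr1), mul_le_mul_of_nonneg_left k2 hr]
  have k4 : planeNorm (m - r • v) = 0 := by
    have := planeNorm_nonneg (m - r • v)
    nlinarith
  exact sub_eq_zero.1 (planeNorm_eq_zero.1 k4)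

/-- The vectorial facet of `w`, in coordinates. -/
def cell (w : ℝ × ℝ) : Set (ℝ × ℝ) :=
  {z | ∀ i, SignType.sign (ell i z) = SignType.sign (ell i w)}

/-- The closure of the vectorial facet of `w`, in coordinates. -/
def closedCell (w : ℝ × ℝ) : Set (ℝ × ℝ) :=
  {z | ∀ i, (ell i w = 0 → ell i z = 0) ∧ 0 ≤ ell i z * ell i w}

theorem mem_cell_self (w : ℝ × ℝ) : w ∈ cell w := fun _ => rfl

theorem cell_eq_of_mem {z w : ℝ × ℝ} (h : z ∈ cell w) : cell z = cell w := by
  ext y; exact ⟨fun hy i => (hy i).trans (h i), fun hy i => (hy i).trans (h i).symm⟩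

theorem sign_eq_iff {a b : ℝ} : SignType.sign a = SignType.sign b ↔
    (b = 0 → a = 0) ∧ (b ≠ 0 → 0 < a * b) := by
  rcases lt_trichotomy a 0 with ha | rfl | ha <;> rcases lt_trichotomy b 0 with hb | rfl | hb <;>
    simp [*, sign_neg, sign_pos, ne_of_lt, ne_of_gt, mul_pos_of_neg_of_neg, le_of_lt]

theorem smul_mem_cell {r : ℝ} (hr : 0 < r) {z w : ℝ × ℝ} (hz : z ∈ cell w) : r • z ∈ cell w := by
  intro i
  rw [map_smul, smul_eq_mul, sign_mul, sign_pos hr, one_mul, hz i]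

theorem zero_mem_closedCell (w : ℝ × ℝ) : (0 : ℝ × ℝ) ∈ closedCell w := fun i => by simp

theorem cell_subset_closedCell (w : ℝ × ℝ) : cell w ⊆ closedCell w := by
  intro z hz i
  have h := sign_eq_iff.1 (hz i)
  by_cases hw : ell i w = 0
  · exact ⟨fun _ => h.1 hw, by simp [hw]⟩
  · exact ⟨fun h' => absurd h' hw, (h.2 hw).le⟩

theorem isClosed_closedCell (w : ℝ × ℝ) : IsClosed (closedCell w) := by
  have hc : ∀ i, Continuous (ell i) := fun i => LinearMap.continuous_of_finiteDimensional _
  have : closedCell w = ⋂ i, ({z | ell i w = 0 → ell i z = 0} ∩ {z | 0 ≤ ell i z * ell i w}) := by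
    ext z; simp [closedCell]
  rw [this]
  refine isClosed_iInter fun i => IsClosed.inter ?_ ?_
  · by_cases hw : ell i w = 0
    · simpa [hw] using isClosed_eq (hc i) continuous_const
    · simp [hw]
  · exact isClosed_le continuous_const ((hc i).mul continuous_const)

theorem add_smul_mem_cell {z w : ℝ × ℝ} (hz : z ∈ closedCell w) {δ : ℝ} (hδ : 0 < δ) :
    z + δ • w ∈ cell w := by
  intro i
  rw [sign_eq_iff, map_add, map_smul, smul_eq_mul]
  refine ⟨fun h => by rw [(hz i).1 h, h]; simp, fun h => ?_⟩
  have := mul_pos hδ (mul_self_pos.2 h)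
  nlinarith [(hz i).2]

theorem closure_cell (w : ℝ × ℝ) : closure (cell w) = closedCell w := by
  refine subset_antisymm
    (closure_minimal (cell_subset_closedCell w) (isClosed_closedCell w)) fun z hz => ?_
  have ht : Filter.Tendsto (fun δ : ℝ => z + δ • w) (𝓝[>] 0) (𝓝 (z + (0 : ℝ) • w)) :=
    (Continuous.tendsto (by fun_prop) 0).mono_left nhdsWithin_le_nhds
  rw [zero_smul, add_zero] at ht
  exact mem_closure_of_tendsto ht (Filter.eventually_of_mem self_mem_nhdsWithin
    fun δ hδ => add_smul_mem_cell hz hδ)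

/-- The vector `w` lies on no wall through the origin. -/
def Generic (w : ℝ × ℝ) : Prop := ∀ i, ell i w ≠ 0

theorem isOpen_cell {w : ℝ × ℝ} (hw : Generic w) : IsOpen (cell w) := by
  have hc : ∀ i, Continuous (ell i) := fun i => LinearMap.continuous_of_finiteDimensional _
  have : cell w = ⋂ i, {z | 0 < ell i z * ell i w} := by
    ext z
    simp only [cell, Set.mem_ofPred_eq, sign_eq_iff, Set.mem_iInter]
    exact forall_congr' fun i => ⟨fun h => h.2 (hw i), fun h => ⟨fun h' => absurd h' (hw i),
      fun _ => h⟩⟩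
  rw [this]
  exact isOpen_iInter_of_finite fun i => isOpen_lt continuous_const ((hc i).mul continuous_const)

theorem mem_closedCell_one_one {z : ℝ × ℝ} : z ∈ closedCell (1, 1) ↔ 0 ≤ z.1 ∧ 0 ≤ z.2 := by
  simp only [closedCell, Set.mem_ofPred_eq, Fin.forall_fin_succ]
  simpa using fun h1 h2 => add_nonneg h1 h2

theorem generic_one_one : Generic (1, 1) := by
  intro i; fin_cases i <;> simp [ell]

theorem generic_neg {w : ℝ × ℝ} (h : Generic w) : Generic (-w) := by
  intro i; simpa using h i

/-! ### Walls, vectorial facets and facets of the plane -/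

/-- The forms `ell i` on the plane itself. -/
noncomputable def root (i : Fin 3) : planeA2 →ₗ[ℝ] ℝ := ell i ∘ₗ coordA2.symm.toLinearMap

theorem root_apply (i : Fin 3) (x : planeA2) : root i x = ell i (coordA2.symm x) := rfl

theorem root_coordA2 (i : Fin 3) (z : ℝ × ℝ) : root i (coordA2 z) = ell i z := by
  simp [root_apply]

theorem root_zero (x : planeA2) : root 0 x =
    ((x : EuclideanSpace ℝ (Fin 3)) 0 - (x : EuclideanSpace ℝ (Fin 3)) 1) / 3 := rfl

theorem root_one (x : planeA2) : root 1 x =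
    ((x : EuclideanSpace ℝ (Fin 3)) 1 - (x : EuclideanSpace ℝ (Fin 3)) 2) / 3 := rfl

theorem root_two (x : planeA2) : root 2 x =
    ((x : EuclideanSpace ℝ (Fin 3)) 0 - (x : EuclideanSpace ℝ (Fin 3)) 2) / 3 := by
  rw [root_apply, ell_two, coordA2_symm_apply]; ring

theorem eq_zero_of_roots {x : planeA2} (h0 : root 0 x = 0) (h1 : root 1 x = 0) : x = 0 := by
  apply coordA2.symm.injective
  rw [map_zero]
  exact Prod.ext h0 h1

theorem finrank_planeA2 : Module.finrank ℝ planeA2 = 2 := by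
  rw [← coordA2.finrank_eq]; simp

theorem exists_root_ne_zero (i : Fin 3) : ∃ x, root i x ≠ 0 :=
  ⟨coordA2 (1, 1), by rw [root_coordA2]; exact generic_one_one i⟩

theorem root_surjective (i : Fin 3) : Function.Surjective (root i) := by
  obtain ⟨x, hx⟩ := exists_root_ne_zero i
  intro c
  exact ⟨(c / root i x) • x, by simp [hx]⟩

theorem finrank_ker_root (i : Fin 3) : Module.finrank ℝ (LinearMap.ker (root i)) = 1 := by
  have h := LinearMap.finrank_range_add_finrank_ker (root i)
  rw [LinearMap.range_eq_top.2 (root_surjective i), finrank_planeA2, finrank_top,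
    Module.finrank_self] at h
  omega

/-- The isometry of the plane given by an involutive permutation of the coordinates. -/
noncomputable def permIso (τ : Equiv.Perm (Fin 3)) (hτ : ∀ i, τ (τ i) = i) :
    planeA2 ≃ₗᵢ[ℝ] planeA2 where
  toLinearEquiv := LinearEquiv.ofInvolutive
    ((LinearIsometryEquiv.piLpCongrLeft 2 ℝ ℝ τ).toLinearEquiv.toLinearMap.restrict
      (p := planeA2) (q := planeA2) (by
        intro x hx
        change ∑ i, x (τ.symm i) = 0
        exact (Equiv.sum_comp τ.symm _).trans hx))
    (by
      intro x
      ext i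
      change (x : EuclideanSpace ℝ (Fin 3)) (τ.symm (τ.symm i)) = _
      rw [show τ.symm (τ.symm i) = i by rw [Equiv.symm_apply_eq, Equiv.symm_apply_eq, hτ]])
  norm_map' x := (LinearIsometryEquiv.piLpCongrLeft 2 ℝ ℝ τ).norm_map x

theorem permIso_apply (τ : Equiv.Perm (Fin 3)) (hτ : ∀ i, τ (τ i) = i) (x : planeA2) (i : Fin 3) :
    (permIso τ hτ x : EuclideanSpace ℝ (Fin 3)) i = (x : EuclideanSpace ℝ (Fin 3)) (τ i) := by
  change (x : EuclideanSpace ℝ (Fin 3)) (τ.symm i) = _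
  rw [show τ.symm i = τ i by rw [Equiv.symm_apply_eq, hτ]]

theorem plane_ext {x y : planeA2} (h : ∀ i, (x : EuclideanSpace ℝ (Fin 3)) i =
    (y : EuclideanSpace ℝ (Fin 3)) i) : x = y := by
  ext i; exact h i

/-- For each root, the coordinate transposition whose fixed vectors are the zeros of the root. -/
theorem exists_swap_root (i : Fin 3) : ∃ τ : Equiv.Perm (Fin 3), (∀ j, τ (τ j) = j) ∧
    ∀ x : planeA2, (∀ j, (x : EuclideanSpace ℝ (Fin 3)) (τ j) =
      (x : EuclideanSpace ℝ (Fin 3)) j) ↔ root i x = 0 := by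
  fin_cases i
  · refine ⟨Equiv.swap 0 1, by decide, fun x => ?_⟩
    have e0 : Equiv.swap (0 : Fin 3) 1 0 = 1 := by decide
    have e1 : Equiv.swap (0 : Fin 3) 1 1 = 0 := by decide
    have e2 : Equiv.swap (0 : Fin 3) 1 2 = 2 := by decide
    change _ ↔ root 0 x = 0
    rw [root_zero, Fin.forall_fin_succ, Fin.forall_fin_two]
    change _ = _ ∧ x.1 (Equiv.swap 0 1 1) = x.1 1 ∧ x.1 (Equiv.swap 0 1 2) = x.1 2 ↔ _
    rw [e0, e1, e2]
    constructor
    · rintro ⟨h, -⟩; rw [h]; simp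
    · intro h; have : x.1 0 = x.1 1 := by linarith
      exact ⟨this.symm, this, rfl⟩
  · refine ⟨Equiv.swap 1 2, by decide, fun x => ?_⟩
    have e0 : Equiv.swap (1 : Fin 3) 2 0 = 0 := by decide
    have e1 : Equiv.swap (1 : Fin 3) 2 1 = 2 := by decide
    have e2 : Equiv.swap (1 : Fin 3) 2 2 = 1 := by decide
    change _ ↔ root 1 x = 0
    rw [root_one, Fin.forall_fin_succ, Fin.forall_fin_two]
    change _ = _ ∧ x.1 (Equiv.swap 1 2 1) = x.1 1 ∧ x.1 (Equiv.swap 1 2 2) = x.1 2 ↔ _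
    rw [e0, e1, e2]
    constructor
    · rintro ⟨-, h, -⟩; rw [h]; simp
    · intro h; have : x.1 1 = x.1 2 := by linarith
      exact ⟨rfl, this.symm, this⟩
  · refine ⟨Equiv.swap 0 2, by decide, fun x => ?_⟩
    have e0 : Equiv.swap (0 : Fin 3) 2 0 = 2 := by decide
    have e1 : Equiv.swap (0 : Fin 3) 2 1 = 1 := by decide
    have e2 : Equiv.swap (0 : Fin 3) 2 2 = 0 := by decide
    change _ ↔ root 2 x = 0
    rw [root_two, Fin.forall_fin_succ, Fin.forall_fin_two]
    change _ = _ ∧ x.1 (Equiv.swap 0 2 1) = x.1 1 ∧ x.1 (Equiv.swap 0 2 2) = x.1 2 ↔ _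
    rw [e0, e1, e2]
    constructor
    · rintro ⟨h, -⟩; rw [h]; simp
    · intro h; have : x.1 0 = x.1 2 := by linarith
      exact ⟨this.symm, rfl, this⟩

theorem perm_fin_three (τ : Equiv.Perm (Fin 3)) :
    (∀ i, τ i = i) ∨ (τ 0 = 1 ∧ τ 1 = 2 ∧ τ 2 = 0) ∨ (τ 0 = 2 ∧ τ 1 = 0 ∧ τ 2 = 1) ∨
    (τ 0 = 1 ∧ τ 1 = 0 ∧ τ 2 = 2) ∨ (τ 0 = 0 ∧ τ 1 = 2 ∧ τ 2 = 1) ∨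
    (τ 0 = 2 ∧ τ 1 = 1 ∧ τ 2 = 0) := by
  revert τ; decide

/-- The direction of a fixed point set is the space of vectors fixed by a coordinate permutation:
the whole plane for the identity, zero for a 3-cycle, the kernel of a root for a transposition.
Conversely a transposition, conjugated by a translation, fixes exactly a prescribed level line. -/
theorem mem_walls_iff {H : AffineSubspace ℝ planeA2} :
    H ∈ walls weylA2 ↔ ∃ i c, ∀ x, x ∈ H ↔ root i x = c := by
  constructor
  · rintro ⟨⟨⟨p, hp⟩, hfr⟩, w, ⟨τ, hτ⟩, hw⟩
    rw [finrank_planeA2] at hfr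
    have hp' : p ∈ H := hp
    have hdir : ∀ v : planeA2, v ∈ H.direction ↔
        ∀ i, (v : EuclideanSpace ℝ (Fin 3)) (τ i) = (v : EuclideanSpace ℝ (Fin 3)) i := by
      intro v
      rw [← AffineSubspace.vadd_mem_iff_mem_direction v hp', ← hw, w.map_vadd, (hw p).2 hp',
        vadd_right_cancel_iff]
      exact ⟨fun h i => by rw [← hτ, h], fun h => plane_ext fun i => by rw [hτ, h]⟩
    suffices h : ∃ i, ∀ v, v ∈ H.direction ↔ root i v = 0 by
      obtain ⟨i, hi⟩ := h
      refine ⟨i, root i p, fun x => ?_⟩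
      rw [← AffineSubspace.vsub_right_mem_direction_iff_mem hp', hi, vsub_eq_sub, map_sub,
        sub_eq_zero]
    have hsum : ∀ v : planeA2, v.1 0 + v.1 1 + v.1 2 = 0 := fun v => by
      have h : ∑ i, v.1 i = 0 := v.2
      rwa [Fin.sum_univ_three] at h
    have hbot : (∀ v ∈ H.direction, v = 0) → False := by
      intro h
      rw [(Submodule.eq_bot_iff _).2 h, finrank_bot] at hfr
      omega
    rcases perm_fin_three τ with h | ⟨h0, h1, h2⟩ | ⟨h0, h1, h2⟩ | ⟨h0, h1, h2⟩ | ⟨h0, h1, h2⟩ |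
      ⟨h0, h1, h2⟩
    · have : H.direction = ⊤ := by
        rw [eq_top_iff]; intro v _; rw [hdir]; intro i; rw [h]
      rw [this, finrank_top, finrank_planeA2] at hfr
      omega
    · refine (hbot fun v hv => ?_).elim
      rw [hdir] at hv
      have k0 := hv 0; have k1 := hv 1; have k2 := hsum v
      rw [h0] at k0; rw [h1] at k1
      exact eq_zero_of_roots (by rw [root_zero]; linarith) (by rw [root_one]; linarith)
    · refine (hbot fun v hv => ?_).elim
      rw [hdir] at hv
      have k0 := hv 0; have k1 := hv 1; have k2 := hsum v
      rw [h0] at k0; rw [h1] at k1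
      exact eq_zero_of_roots (by rw [root_zero]; linarith) (by rw [root_one]; linarith)
    · refine ⟨0, fun v => ?_⟩
      rw [hdir, Fin.forall_fin_succ, Fin.forall_fin_two, root_zero]
      change v.1 (τ 0) = _ ∧ v.1 (τ 1) = v.1 1 ∧ v.1 (τ 2) = v.1 2 ↔ _
      rw [h0, h1, h2]
      exact ⟨fun h => by linarith [h.1], fun h => ⟨by linarith, by linarith, rfl⟩⟩
    · refine ⟨1, fun v => ?_⟩
      rw [hdir, Fin.forall_fin_succ, Fin.forall_fin_two, root_one]
      change v.1 (τ 0) = _ ∧ v.1 (τ 1) = v.1 1 ∧ v.1 (τ 2) = v.1 2 ↔ _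
      rw [h0, h1, h2]
      exact ⟨fun h => by linarith [h.2.1], fun h => ⟨rfl, by linarith, by linarith⟩⟩
    · refine ⟨2, fun v => ?_⟩
      rw [hdir, Fin.forall_fin_succ, Fin.forall_fin_two, root_two]
      change v.1 (τ 0) = _ ∧ v.1 (τ 1) = v.1 1 ∧ v.1 (τ 2) = v.1 2 ↔ _
      rw [h0, h1, h2]
      exact ⟨fun h => by linarith [h.1], fun h => ⟨by linarith, rfl, by linarith⟩⟩
  · rintro ⟨i, c, hH⟩
    obtain ⟨p, hp⟩ := root_surjective i c
    have hpH : p ∈ H := (hH p).2 hp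
    have hdir : H.direction = LinearMap.ker (root i) := by
      ext v
      rw [← AffineSubspace.vadd_mem_iff_mem_direction v hpH, hH, vadd_eq_add, map_add, hp,
        LinearMap.mem_ker, add_eq_right]
    refine ⟨⟨⟨p, hpH⟩, by rw [hdir, finrank_ker_root, finrank_planeA2]⟩, ?_⟩
    obtain ⟨τ, hτ, hτi⟩ := exists_swap_root i
    let w : planeA2 ≃ᵃⁱ[ℝ] planeA2 := AffineIsometryEquiv.mk' (fun x => permIso τ hτ (x - p) + p)
      (permIso τ hτ) p (by intro x; simp)
    have hwl : w.linearIsometryEquiv = permIso τ hτ := AffineIsometryEquiv.linearIsometryEquiv_mk' ..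
    have hwx : ∀ x, w x = permIso τ hτ (x - p) + p := fun x => rfl
    refine ⟨w, ⟨τ, fun v j => by rw [hwl, permIso_apply]⟩, fun x => ?_⟩
    rw [hH, hwx, ← eq_sub_iff_add_eq]
    have := hτi (x - p)
    rw [map_sub, hp, sub_eq_zero] at this
    rw [← this]
    exact ⟨fun h j => by rw [← permIso_apply τ hτ, h], fun h => plane_ext fun j => by
      rw [permIso_apply, h]⟩

theorem exists_wall (i : Fin 3) (c : ℝ) :
    ∃ H ∈ walls weylA2, ∀ x, x ∈ H ↔ root i x = c := by
  obtain ⟨p, hp⟩ := root_surjective i c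
  refine ⟨AffineSubspace.mk' p (LinearMap.ker (root i)), ?_, ?_⟩ <;>
  have : ∀ x, x ∈ AffineSubspace.mk' p (LinearMap.ker (root i)) ↔ root i x = c := fun x => by
    rw [AffineSubspace.mem_mk', LinearMap.mem_ker, vsub_eq_sub, map_sub, hp, sub_eq_zero]
  · exact mem_walls_iff.2 ⟨i, c, this⟩
  · exact this

theorem mem_direction_of_wall {H : AffineSubspace ℝ planeA2} {i : Fin 3} {c : ℝ}
    (hH : ∀ x, x ∈ H ↔ root i x = c) (v : planeA2) : v ∈ H.direction ↔ root i v = 0 := by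
  obtain ⟨p, hp⟩ := root_surjective i c
  have hpH : p ∈ H := (hH p).2 hp
  rw [← AffineSubspace.vadd_mem_iff_mem_direction v hpH, hH, vadd_eq_add, map_add, hp,
    add_eq_right]

theorem mem_vectorWalls_iff {U : AffineSubspace ℝ planeA2} :
    U ∈ vectorWalls weylA2 ↔ ∃ i, ∀ x, x ∈ U ↔ root i x = 0 := by
  constructor
  · rintro ⟨H, hH, rfl⟩
    obtain ⟨i, c, hi⟩ := mem_walls_iff.1 hH
    exact ⟨i, fun x => by rw [Submodule.mem_toAffineSubspace, mem_direction_of_wall hi]⟩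
  · rintro ⟨i, hi⟩
    obtain ⟨H, hH, h⟩ := exists_wall i 0
    refine ⟨H, hH, ?_⟩
    ext x
    rw [hi]
    exact (mem_direction_of_wall h x).symm

theorem exists_vectorWall (i : Fin 3) :
    ∃ U ∈ vectorWalls weylA2, ∀ x, x ∈ U ↔ root i x = 0 := by
  obtain ⟨H, hH, h⟩ := exists_wall i 0
  exact ⟨H, mem_vectorWalls_iff.2 ⟨i, h⟩, h⟩

theorem sSameSide_iff {H : AffineSubspace ℝ planeA2} {i : Fin 3} {c : ℝ}
    (hH : ∀ x, x ∈ H ↔ root i x = c) (x y : planeA2) :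
    H.SSameSide x y ↔ 0 < (root i x - c) * (root i y - c) := by
  constructor
  · rintro ⟨⟨p, hp, q, hq, hs⟩, hx, hy⟩
    rw [hH] at hp hq hx hy
    have h := hs.map (root i)
    rw [vsub_eq_sub, vsub_eq_sub, map_sub, map_sub, hp, hq] at h
    have hx' : root i x - c ≠ 0 := sub_ne_zero.2 hx
    have hy' : root i y - c ≠ 0 := sub_ne_zero.2 hy
    obtain ⟨r, hr, h'⟩ := (h.exists_pos_left hx' hy')
    rw [← h', smul_eq_mul]
    have := mul_self_pos.2 hx'
    nlinarith [mul_pos hr this]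
  · intro h
    have hx : root i x - c ≠ 0 := left_ne_zero_of_mul h.ne'
    have hy : root i y - c ≠ 0 := right_ne_zero_of_mul h.ne'
    refine ⟨?_, by rw [hH]; exact sub_ne_zero.1 hx, by rw [hH]; exact sub_ne_zero.1 hy⟩
    obtain ⟨n, hn⟩ := root_surjective i 1
    refine ⟨x - (root i x - c) • n, ?_, y - (root i y - c) • n, ?_, ?_⟩
    · rw [hH]; simp [hn]
    · rw [hH]; simp [hn]
    · rw [vsub_eq_sub, vsub_eq_sub, sub_sub_cancel, sub_sub_cancel]
      have hd : (root i y - c) • n = ((root i y - c) / (root i x - c)) • ((root i x - c) • n) := by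
        rw [smul_smul, div_mul_cancel₀ _ hx]
      rw [hd]
      refine SameRay.sameRay_pos_smul_right _ ?_
      rw [← mul_div_mul_right _ _ hx, mul_comm (root i y - c)]
      exact div_pos h (mul_self_pos.2 hx)

theorem vectorFacet_class (v : planeA2) :
    {u | ∀ D ∈ wallsAndOpenHalves (vectorWalls weylA2), u ∈ D ↔ v ∈ D} =
      coordA2 '' cell (coordA2.symm v) := by
  have key : ∀ u, (∀ D ∈ wallsAndOpenHalves (vectorWalls weylA2), u ∈ D ↔ v ∈ D) ↔
      ∀ i, SignType.sign (root i u) = SignType.sign (root i v) := by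
    intro u
    constructor
    · intro h i
      obtain ⟨U, hU, hUi⟩ := exists_vectorWall i
      rw [sign_eq_iff]
      refine ⟨fun hv => (hUi u).1 ((h U ⟨U, hU, Or.inl rfl⟩).2 ((hUi v).2 hv)), fun hv => ?_⟩
      have hvU : v ∉ U := fun h' => hv ((hUi v).1 h')
      have := (h {y | U.SSameSide v y} ⟨U, hU, Or.inr ⟨v, hvU, rfl⟩⟩).2
        (AffineSubspace.sSameSide_self_iff.2 ⟨⟨0, (hUi 0).2 (map_zero _)⟩, hvU⟩)
      have := (sSameSide_iff hUi v u).1 this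
      rwa [sub_zero, sub_zero, mul_comm] at this
    · rintro h D ⟨U, hU, hD⟩
      obtain ⟨i, hi⟩ := mem_vectorWalls_iff.1 hU
      have hs := h i
      rcases hD with rfl | ⟨z, hz, rfl⟩
      · change u ∈ U ↔ v ∈ U
        rw [hi, hi, ← sign_eq_zero_iff, hs, sign_eq_zero_iff]
      · change U.SSameSide z u ↔ U.SSameSide z v
        rw [sSameSide_iff hi, sSameSide_iff hi, sub_zero, sub_zero, sub_zero, ← sign_eq_one_iff,
          sign_mul, hs, ← sign_mul, sign_eq_one_iff]
  ext u
  rw [Set.mem_ofPred_eq, key]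
  constructor
  · intro h
    exact ⟨coordA2.symm u, h, by simp⟩
  · rintro ⟨z, hz, rfl⟩ i
    rw [root_coordA2]
    exact hz i

theorem isVectorFacet_iff {F : Set planeA2} :
    IsVectorFacet weylA2 F ↔ ∃ w, F = coordA2 '' cell w := by
  constructor
  · rintro ⟨v, rfl⟩; exact ⟨_, vectorFacet_class v⟩
  · rintro ⟨w, rfl⟩
    exact ⟨coordA2 w, by rw [vectorFacet_class, LinearEquiv.symm_apply_apply]⟩

theorem closure_coordA2_image (s : Set (ℝ × ℝ)) :
    closure (coordA2 '' s) = coordA2 '' closure s :=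
  (coordHomeo.image_closure s).symm

theorem closure_vectorFacet (w : ℝ × ℝ) : closure (coordA2 '' cell w) = coordA2 '' closedCell w := by
  rw [closure_coordA2_image, closure_cell]

/-- The germ at `u` of the sets `u + cell w`. -/
def planeGerm (u w : ℝ × ℝ) : Filter (ℝ × ℝ) := Filter.map (fun z => u + z) (𝓝[cell w] 0)

theorem mem_planeGerm {u w : ℝ × ℝ} {Z : Set (ℝ × ℝ)} :
    Z ∈ planeGerm u w ↔ ∃ ε > 0, ∀ z ∈ cell w, planeNorm z < ε → u + z ∈ Z := by
  rw [planeGerm, Filter.mem_map, (nhdsWithin_hasBasis (nhds_hasBasis_planeNorm 0) _).mem_iff]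
  simp only [sub_zero]
  exact ⟨fun ⟨ε, h, k⟩ => ⟨ε, h, fun z hz hn => k ⟨hn, hz⟩⟩,
    fun ⟨ε, h, k⟩ => ⟨ε, h, fun z hz => k z hz.2 hz.1⟩⟩

theorem vadd_image_coord (u w : ℝ × ℝ) {x : planeA2} :
    x ∈ coordA2 u +ᵥ coordA2 '' cell w ↔ ∃ z ∈ cell w, coordA2 (u + z) = x := by
  rw [Set.mem_vadd_set]
  constructor
  · rintro ⟨_, ⟨z, hz, rfl⟩, rfl⟩
    exact ⟨z, hz, map_add _ _ _⟩
  · rintro ⟨z, hz, rfl⟩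
    exact ⟨_, ⟨z, hz, rfl⟩, (map_add _ _ _).symm⟩

theorem openHalf_mem {i : Fin 3} {c : ℝ} {z : planeA2} (hz : root i z ≠ c) :
    {y | 0 < (root i z - c) * (root i y - c)} ∈ wallsAndOpenHalves (walls weylA2) := by
  obtain ⟨H, hH, h⟩ := exists_wall i c
  refine ⟨H, hH, Or.inr ⟨z, fun h' => hz ((h z).1 h'), ?_⟩⟩
  ext y
  exact (sSameSide_iff h z y).symm

theorem wall_mem (i : Fin 3) (c : ℝ) :
    {y | root i y = c} ∈ wallsAndOpenHalves (walls weylA2) := by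
  obtain ⟨H, hH, h⟩ := exists_wall i c
  refine ⟨H, hH, Or.inl ?_⟩
  ext y
  exact (h y).symm

theorem signSet_mem (u w : ℝ × ℝ) (i : Fin 3) :
    {x | SignType.sign (root i x - ell i u) = SignType.sign (ell i w)} ∈
      wallsAndOpenHalves (walls weylA2) := by
  by_cases hw : ell i w = 0
  · convert wall_mem i (ell i u) using 1
    ext x
    simp [hw, sign_eq_zero_iff, sub_eq_zero]
  · convert openHalf_mem (i := i) (c := ell i u) (z := coordA2 (u + w)) ?_ using 1
    · ext x
      simp [root_coordA2, sign_eq_iff, hw, mul_comm]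
    · simpa [root_coordA2] using hw

theorem continuous_root (i : Fin 3) : Continuous (root i) :=
  LinearMap.continuous_of_finiteDimensional _

/-- Passing to intersections of walls and open half apartments loses nothing: three sign conditions
cut out `u + cell w` exactly, and strips between parallel walls form arbitrarily small
neighbourhoods of `u`. A facet is thus an ordinary germ. -/
theorem facetFilter_eq (u w : ℝ × ℝ) :
    facetFilter weylA2 (coordA2 u) (coordA2 '' cell w) = Filter.map coordA2 (planeGerm u w) := by
  ext Z
  rw [Filter.mem_map]
  constructor
  · rintro ⟨Ds, -, -, ⟨U, hU, hUD⟩, hDZ⟩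
    rw [planeGerm, Filter.mem_map]
    have hc : Filter.Tendsto (fun z => coordA2 (u + z)) (𝓝 0) (𝓝 (coordA2 u)) := by
      have : Continuous fun z => coordA2 (u + z) := continuous_coordA2.comp (by fun_prop)
      simpa using this.tendsto 0
    filter_upwards [nhdsWithin_le_nhds (hc hU), self_mem_nhdsWithin] with z hz hz'
    exact hDZ (hUD ⟨hz, (vadd_image_coord u w).2 ⟨z, hz', rfl⟩⟩)
  · intro h
    obtain ⟨ε, hε, h⟩ := mem_planeGerm.1 h
    let S : Fin 3 → Set planeA2 := fun i =>
      {x | SignType.sign (root i x - ell i u) = SignType.sign (ell i w)}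
    let T : Fin 3 → Set planeA2 := fun i =>
      {y | 0 < (root i (coordA2 u) - (ell i u + ε / 5)) * (root i y - (ell i u + ε / 5))}
    let T' : Fin 3 → Set planeA2 := fun i =>
      {y | 0 < (root i (coordA2 u) - (ell i u - ε / 5)) * (root i y - (ell i u - ε / 5))}
    -- If both coordinates of `y - u` are less than `ε / 5` in absolute value, its squared length is
    -- less than `18 ε² / 25`, hence less than `ε²`.
    have hε5 : 0 < ε / 5 := by positivity
    have hT : ∀ i y, y ∈ T i ↔ root i y - ell i u < ε / 5 := fun i y => by
      change 0 < (root i (coordA2 u) - (ell i u + ε / 5)) * (root i y - (ell i u + ε / 5)) ↔ _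
      rw [root_coordA2, show ell i u - (ell i u + ε / 5) = - (ε / 5) by ring]
      constructor <;> intro h' <;> nlinarith
    have hT' : ∀ i y, y ∈ T' i ↔ - (ε / 5) < root i y - ell i u := fun i y => by
      change 0 < (root i (coordA2 u) - (ell i u - ε / 5)) * (root i y - (ell i u - ε / 5)) ↔ _
      rw [root_coordA2, show ell i u - (ell i u - ε / 5) = ε / 5 by ring]
      constructor <;> intro h' <;> nlinarith
    have hmem : ∀ x, x ∈ ⋂₀ (Set.range S ∪ (Set.range T ∪ Set.range T')) ↔
        (∀ i, x ∈ S i) ∧ (∀ i, x ∈ T i) ∧ ∀ i, x ∈ T' i := fun x => by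
      simp [Set.sInter_union]
    refine ⟨Set.range S ∪ (Set.range T ∪ Set.range T'), (Set.finite_range _).union
      ((Set.finite_range _).union (Set.finite_range _)), ?_, ⟨(⋂ i, T i) ∩ ⋂ i, T' i, ?_, ?_⟩, ?_⟩
    · rintro D (⟨i, rfl⟩ | ⟨i, rfl⟩ | ⟨i, rfl⟩)
      · exact signSet_mem u w i
      · exact openHalf_mem (by rw [root_coordA2]; linarith)
      · exact openHalf_mem (by rw [root_coordA2]; linarith)
    · refine Filter.inter_mem (Filter.iInter_mem.2 fun i => ?_) (Filter.iInter_mem.2 fun i => ?_)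
      · exact (isOpen_lt continuous_const (continuous_const.mul
          ((continuous_root i).sub continuous_const))).mem_nhds
          ((hT i _).2 (by rw [root_coordA2, sub_self]; exact hε5))
      · exact (isOpen_lt continuous_const (continuous_const.mul
          ((continuous_root i).sub continuous_const))).mem_nhds
          ((hT' i _).2 (by rw [root_coordA2, sub_self]; linarith))
    · rintro x ⟨⟨h1, h2⟩, hx⟩
      rw [Set.mem_iInter] at h1 h2
      refine (hmem x).2 ⟨fun i => ?_, h1, h2⟩
      obtain ⟨z, hz, rfl⟩ := (vadd_image_coord u w).1 hx
      change SignType.sign (root i (coordA2 (u + z)) - ell i u) = _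
      rw [root_coordA2, map_add, add_sub_cancel_left]
      exact hz i
    · intro x hx
      obtain ⟨h1, h2, h3⟩ := (hmem x).1 hx
      obtain ⟨y, rfl⟩ := coordA2.surjective x
      have e : ∀ i, root i (coordA2 y) - ell i u = ell i (y - u) := fun i => by
        rw [root_coordA2, map_sub]
      have := h (y - u) (fun i => (congrArg SignType.sign (e i)).symm.trans (h1 i)) ?_
      · rwa [add_sub_cancel] at this
      · have a1 := (hT 0 _).1 (h2 0)
        have a2 := (hT 1 _).1 (h2 1)
        have b1 := (hT' 0 _).1 (h3 0)
        have b2 := (hT' 1 _).1 (h3 1)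
        rw [e] at a1 a2 b1 b2
        rw [ell_zero] at a1 b1
        rw [ell_one] at a2 b2
        refine lt_of_pow_lt_pow_left₀ 2 hε.le ?_
        rw [planeNorm_sq]
        have c1 := sq_lt_sq' b1 a1
        have c2 := sq_lt_sq' b2 a2
        nlinarith [sq_nonneg ((y - u).1 - (y - u).2)]

theorem modelFacets_eq : modelFacets weylA2 =
    Set.range fun p : (ℝ × ℝ) × (ℝ × ℝ) => Filter.map coordA2 (planeGerm p.1 p.2) := by
  ext σ
  constructor
  · rintro ⟨x, F, hF, rfl⟩
    obtain ⟨w, rfl⟩ := isVectorFacet_iff.1 hF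
    refine ⟨(coordA2.symm x, w), ?_⟩
    change Filter.map coordA2 (planeGerm (coordA2.symm x) w) = _
    rw [← facetFilter_eq, LinearEquiv.apply_symm_apply]
  · rintro ⟨⟨u, w⟩, rfl⟩
    exact ⟨coordA2 u, _, isVectorFacet_iff.2 ⟨w, rfl⟩, (facetFilter_eq u w).symm⟩

/-- Every vector lies in the closure of a chamber. -/
theorem exists_generic_closedCell (v : ℝ × ℝ) : ∃ w, Generic w ∧ v ∈ closedCell w := by
  have hg : ∀ a b : ℝ, a ≠ 0 → b ≠ 0 → a + b ≠ 0 → Generic (a, b) := by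
    intro a b h1 h2 h3 i; fin_cases i <;> simpa [ell]
  have hm : ∀ a b : ℝ, a ≠ 0 → b ≠ 0 → a + b ≠ 0 → 0 ≤ v.1 * a → 0 ≤ v.2 * b →
      0 ≤ (v.1 + v.2) * (a + b) → v ∈ closedCell (a, b) := by
    intro a b h1 h2 h3 k1 k2 k3 i
    refine ⟨fun h => absurd h (hg a b h1 h2 h3 i), ?_⟩
    fin_cases i
    · exact k1
    · exact k2
    · exact k3
  have main : ∃ a b : ℝ, a ≠ 0 ∧ b ≠ 0 ∧ a + b ≠ 0 ∧ 0 ≤ v.1 * a ∧ 0 ≤ v.2 * b ∧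
      0 ≤ (v.1 + v.2) * (a + b) := by
    rcases le_total 0 v.1 with h1 | h1 <;> rcases le_total 0 v.2 with h2 | h2 <;>
      rcases le_total 0 (v.1 + v.2) with h3 | h3
    · exact ⟨1, 1, by norm_num, by norm_num, by norm_num, by linarith, by linarith, by linarith⟩
    · exact ⟨1, 1, by norm_num, by norm_num, by norm_num, by linarith, by linarith, by linarith⟩
    · exact ⟨2, -1, by norm_num, by norm_num, by norm_num, by linarith, by linarith, by linarith⟩
    · exact ⟨1, -2, by norm_num, by norm_num, by norm_num, by linarith, by linarith, by linarith⟩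
    · exact ⟨-1, 2, by norm_num, by norm_num, by norm_num, by linarith, by linarith, by linarith⟩
    · exact ⟨-2, 1, by norm_num, by norm_num, by norm_num, by linarith, by linarith, by linarith⟩
    · exact ⟨-1, -1, by norm_num, by norm_num, by norm_num, by linarith, by linarith, by linarith⟩
    · exact ⟨-1, -1, by norm_num, by norm_num, by norm_num, by linarith, by linarith, by linarith⟩
  obtain ⟨a, b, h1, h2, h3, k1, k2, k3⟩ := main
  exact ⟨(a, b), hg a b h1 h2 h3, hm a b h1 h2 h3 k1 k2 k3⟩

theorem cell_subset_closedCell_of_mem {v w : ℝ × ℝ} (hw : Generic w) (h : v ∈ closedCell w) :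
    cell v ⊆ closedCell w := by
  intro z hz i
  refine ⟨fun h' => absurd h' (hw i), ?_⟩
  have h1 := sign_eq_iff.1 (hz i)
  have h2 := (h i).2
  by_cases hv : ell i v = 0
  · rw [h1.1 hv, zero_mul]
  · have h3 := h1.2 hv
    have h4 := mul_self_pos.2 hv
    by_contra h5
    nlinarith [mul_nonneg h3.le h2]

/-- Maximality is tested against a generic cell whose closure contains the given one. -/
theorem weylChamber_eq {C : Set planeA2} (hC : IsWeylChamber weylA2 C) :
    ∃ w, Generic w ∧ C = coordA2 '' cell w := by
  obtain ⟨v, rfl⟩ := isVectorFacet_iff.1 hC.1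
  obtain ⟨w, hw, hv⟩ := exists_generic_closedCell v
  refine ⟨w, hw, (hC.2 _ (isVectorFacet_iff.2 ⟨w, rfl⟩) ?_).symm⟩
  rw [closure_vectorFacet]
  exact Set.image_mono (cell_subset_closedCell_of_mem hw hv)

/-- The condition on the support excludes both extremes: the origin lies on all the vectorial walls,
which meet in a point, while a chamber lies on none, and the empty infimum is the whole plane. -/
theorem vectorPanel_eq {F : Set planeA2} (hF : IsVectorPanel weylA2 F) :
    ∃ w, w ≠ 0 ∧ ¬ Generic w ∧ F = coordA2 '' cell w := by
  obtain ⟨w, rfl⟩ := isVectorFacet_iff.1 hF.1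
  have hfr := hF.2.2
  rw [finrank_planeA2] at hfr
  refine ⟨w, ?_, ?_, rfl⟩
  · rintro rfl
    have h0 : ∀ z ∈ cell 0, z = 0 := by
      intro z hz
      have h0 := hz 0; have h1 := hz 1
      simp only [map_zero, sign_zero, sign_eq_zero_iff] at h0 h1
      exact Prod.ext h0 h1
    have hall : ∀ U ∈ vectorWalls weylA2, coordA2 '' cell 0 ⊆ (U : Set planeA2) := by
      rintro U hU _ ⟨z, hz, rfl⟩
      obtain ⟨i, hi⟩ := mem_vectorWalls_iff.1 hU
      rw [h0 z hz, map_zero]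
      exact (hi 0).2 (map_zero _)
    have hbot : (sInf {U : AffineSubspace ℝ planeA2 | U ∈ vectorWalls weylA2 ∧
        coordA2 '' cell 0 ⊆ (U : Set planeA2)}).direction = ⊥ := by
      rw [Submodule.eq_bot_iff]
      intro v hv
      have hr : ∀ i, root i v = 0 := by
        intro i
        obtain ⟨U, hU, hi⟩ := exists_vectorWall i
        exact (mem_direction_of_wall hi v).1
          (AffineSubspace.direction_le (sInf_le (show U ∈ {U : AffineSubspace ℝ planeA2 |
            U ∈ vectorWalls weylA2 ∧ coordA2 '' cell 0 ⊆ (U : Set planeA2)} from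
            ⟨hU, hall U hU⟩)) hv)
      exact eq_zero_of_roots (hr 0) (hr 1)
    rw [hbot, finrank_bot] at hfr
    omega
  · intro hw
    have hempty : {U : AffineSubspace ℝ planeA2 | U ∈ vectorWalls weylA2 ∧
        coordA2 '' cell w ⊆ (U : Set planeA2)} = ∅ := by
      rw [Set.eq_empty_iff_forall_notMem]
      rintro U ⟨hU, h⟩
      obtain ⟨i, hi⟩ := mem_vectorWalls_iff.1 hU
      have := (hi _).1 (h ⟨w, mem_cell_self w, rfl⟩)
      rw [root_coordA2] at this
      exact hw i this
    rw [hempty, sInf_empty, AffineSubspace.direction_top, finrank_top, finrank_planeA2] at hfr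
    omega

/-! ### Charts in coordinates -/

/-- A chart of the apartment `A`, written in the coordinates `coordA2`. -/
structure IsPlaneChart {X : Type*} (B : BuildingData X) (A : Set X) (g : ℝ × ℝ → X) : Prop where
  injective : Function.Injective g
  range_eq : Set.range g = A
  dist_eq : ∀ u v, B.dA A (g u) (g v) = planeNorm (u - v)
  facets_eq : (Set.range fun p : (ℝ × ℝ) × (ℝ × ℝ) => Filter.map g (planeGerm p.1 p.2)) =
    B.facetsIn A

variable {X : Type*} {B : BuildingData X}

theorem isPlaneChart_iff {A : Set X} {g : ℝ × ℝ → X} :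
    IsPlaneChart B A g ↔ B.IsChart weylA2 A (g ∘ coordA2.symm) := by
  have hr : Set.range (g ∘ coordA2.symm) = Set.range g :=
    coordA2.symm.surjective.range_comp g
  have hf : Filter.map (g ∘ coordA2.symm) '' modelFacets weylA2 =
      Set.range fun p : (ℝ × ℝ) × (ℝ × ℝ) => Filter.map g (planeGerm p.1 p.2) := by
    rw [modelFacets_eq, ← Set.range_comp]
    congr 1
    funext p
    simp only [Function.comp_apply, Filter.map_map]
    congr 1
    funext z
    simp
  constructor
  · intro h
    refine ⟨h.injective.comp coordA2.symm.injective, hr.trans h.range_eq, fun u v => ?_,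
      hf.trans h.facets_eq⟩
    rw [Function.comp_apply, Function.comp_apply, h.dist_eq, ← dist_coordA2]
    simp
  · rintro ⟨h1, h2, h3, h4⟩
    refine ⟨fun a b hab => coordA2.injective (h1 (by simpa using hab)), hr.symm.trans h2,
      fun u v => ?_, hf.symm.trans h4⟩
    have := h3 (coordA2 u) (coordA2 v)
    rw [dist_coordA2] at this
    simpa using this

theorem BuildingData.IsChart.isPlaneChart {A : Set X} {f : planeA2 → X}
    (h : B.IsChart weylA2 A f) : IsPlaneChart B A (f ∘ coordA2) := by
  rw [isPlaneChart_iff]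
  convert h using 1
  funext z
  simp

/-- The charts of all apartments, in coordinates. -/
def planeCharts (B : BuildingData X) : Set (ℝ × ℝ → X) :=
  {g | Set.range g ∈ B.apartments ∧ IsPlaneChart B (Set.range g) g}

theorem IsPlaneChart.mem {A : Set X} {g : ℝ × ℝ → X} (h : IsPlaneChart B A g)
    (hA : A ∈ B.apartments) : g ∈ planeCharts B := by
  obtain rfl := h.range_eq
  exact ⟨hA, h⟩

/-- The facet which is the image of the germ of `u + cell w` under `g`. -/
def germ (g : ℝ × ℝ → X) (u w : ℝ × ℝ) : Filter X := Filter.map g (planeGerm u w)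

theorem mem_germ {g : ℝ × ℝ → X} {u w : ℝ × ℝ} {Z : Set X} :
    Z ∈ germ g u w ↔ ∃ ε > 0, ∀ z ∈ cell w, planeNorm z < ε → g (u + z) ∈ Z := by
  rw [germ, Filter.mem_map, mem_planeGerm]; rfl

theorem cell_zero : cell 0 = {0} := by
  ext z
  constructor
  · intro hz
    have h0 := hz 0; have h1 := hz 1
    simp only [map_zero, sign_zero, sign_eq_zero_iff] at h0 h1
    exact Prod.ext h0 h1
  · rintro rfl; exact mem_cell_self 0

/-- For `w = 0` the germ is the principal filter of a point, so statements about pairs of facets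
also apply to points. -/
theorem mem_germ_zero {g : ℝ × ℝ → X} {u : ℝ × ℝ} {Z : Set X} :
    Z ∈ germ g u 0 ↔ g u ∈ Z := by
  rw [mem_germ, cell_zero]
  constructor
  · rintro ⟨ε, hε, h⟩; simpa using h 0 rfl (by rwa [planeNorm_zero])
  · intro h; exact ⟨1, one_pos, by rintro z rfl -; simpa using h⟩

theorem germ_zero (g : ℝ × ℝ → X) (u : ℝ × ℝ) : germ g u 0 = pure (g u) := by
  ext Z; rw [mem_germ_zero, Filter.mem_pure]

theorem range_mem_germ (g : ℝ × ℝ → X) (u w : ℝ × ℝ) : Set.range g ∈ germ g u w :=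
  Filter.mem_map.2 (by simp)

theorem germ_mem_facetsIn {A : Set X} {g : ℝ × ℝ → X} (hg : IsPlaneChart B A g) (u w : ℝ × ℝ) :
    germ g u w ∈ B.facetsIn A := by
  rw [← hg.facets_eq]; exact ⟨(u, w), rfl⟩

theorem germ_mem_facets {g : ℝ × ℝ → X} (hg : g ∈ planeCharts B) (u w : ℝ × ℝ) :
    germ g u w ∈ B.facets := (germ_mem_facetsIn hg.2 u w).1

theorem exists_eq_germ {A : Set X} {g : ℝ × ℝ → X} (hg : IsPlaneChart B A g) {σ : Filter X}
    (hσ : σ ∈ B.facets) (h : A ∈ σ) : ∃ u w, σ = germ g u w := by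
  have : σ ∈ B.facetsIn A := ⟨hσ, h⟩
  rw [← hg.facets_eq] at this
  obtain ⟨p, hp⟩ := this
  exact ⟨p.1, p.2, hp.symm⟩

/-- `k` and `g` agree near `u` on the closure of `u + cell w`. -/
def AgreeAt (k g : ℝ × ℝ → X) (u w : ℝ × ℝ) : Prop :=
  ∃ ε > 0, ∀ z ∈ closedCell w, planeNorm z < ε → k (u + z) = g (u + z)

theorem AgreeAt.refl (g : ℝ × ℝ → X) (u w : ℝ × ℝ) : AgreeAt g g u w :=
  ⟨1, one_pos, fun _ _ _ => rfl⟩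

theorem AgreeAt.symm {k g : ℝ × ℝ → X} {u w : ℝ × ℝ} (h : AgreeAt k g u w) : AgreeAt g k u w := by
  obtain ⟨ε, hε, h⟩ := h
  exact ⟨ε, hε, fun z hz hn => (h z hz hn).symm⟩

theorem AgreeAt.trans {k g h : ℝ × ℝ → X} {u w : ℝ × ℝ} (h1 : AgreeAt k g u w)
    (h2 : AgreeAt g h u w) : AgreeAt k h u w := by
  obtain ⟨ε, hε, h1⟩ := h1
  obtain ⟨δ, hδ, h2⟩ := h2
  exact ⟨min ε δ, lt_min hε hδ, fun z hz hn => (h1 z hz (hn.trans_le (min_le_left _ _))).trans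
    (h2 z hz (hn.trans_le (min_le_right _ _)))⟩

theorem AgreeAt.apply_eq {k g : ℝ × ℝ → X} {u w : ℝ × ℝ} (h : AgreeAt k g u w) : k u = g u := by
  obtain ⟨ε, hε, h⟩ := h
  simpa using h 0 (zero_mem_closedCell w) (by rwa [planeNorm_zero])

theorem AgreeAt.germ_eq {k g : ℝ × ℝ → X} {u w : ℝ × ℝ} (h : AgreeAt k g u w) :
    germ k u w = germ g u w := by
  obtain ⟨ε, hε, h⟩ := h
  have key : ∀ k g : ℝ × ℝ → X, (∀ z ∈ closedCell w, planeNorm z < ε → k (u + z) = g (u + z)) →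
      germ k u w ≤ germ g u w := by
    intro k g h Z hZ
    obtain ⟨δ, hδ, h'⟩ := mem_germ.1 hZ
    refine mem_germ.2 ⟨min ε δ, lt_min hε hδ, fun z hz hn => ?_⟩
    rw [h z (cell_subset_closedCell w hz) (hn.trans_le (min_le_left _ _))]
    exact h' z hz (hn.trans_le (min_le_right _ _))
  exact le_antisymm (key k g h) (key g k fun z hz hn => (h z hz hn).symm)

theorem AgreeAt.range_mem {k g : ℝ × ℝ → X} {u w : ℝ × ℝ} (h : AgreeAt k g u w) :
    Set.range k ∈ germ g u w := h.germ_eq ▸ range_mem_germ k u w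

/-- Two facets lie in a common apartment. -/
theorem exists_common_chart (hB : IsAffineBuilding weylA2 B) {g h : ℝ × ℝ → X}
    (hg : g ∈ planeCharts B) (hh : h ∈ planeCharts B) (u w u' w' : ℝ × ℝ) :
    ∃ k ∈ planeCharts B, Set.range k ∈ germ g u w ∧ Set.range k ∈ germ h u' w' := by
  obtain ⟨A, hA, h1, h2⟩ := hB.exists_apartment _ (germ_mem_facets hg u w) _
    (germ_mem_facets hh u' w')
  obtain ⟨f, hf⟩ := hB.exists_chart A hA
  refine ⟨_, hf.isPlaneChart.mem hA, ?_⟩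
  rw [hf.isPlaneChart.range_eq]
  exact ⟨h1, h2⟩

/-- An apartment containing two facets of `g` has a chart which agrees with `g` on them. -/
theorem exists_chart_agreeAt (hB : IsAffineBuilding weylA2 B) {g h : ℝ × ℝ → X}
    (hg : g ∈ planeCharts B) (hh : h ∈ planeCharts B) {u w u' w' : ℝ × ℝ}
    (h1 : Set.range h ∈ germ g u w) (h2 : Set.range h ∈ germ g u' w') :
    ∃ k ∈ planeCharts B, Set.range k = Set.range h ∧ AgreeAt k g u w ∧ AgreeAt k g u' w' := by
  obtain ⟨φ, ⟨hφ, hφd, hφf⟩, f1, f2⟩ := hB.exists_iso _ hg.1 _ hh.1 (germ g u w)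
    ⟨germ_mem_facets hg u w, Filter.inter_mem (range_mem_germ g u w) h1⟩ (germ g u' w')
    ⟨germ_mem_facets hg u' w', Filter.inter_mem (range_mem_germ g u' w') h2⟩
  have hr : Set.range (φ ∘ g) = Set.range h := by rw [Set.range_comp, hφ.image_eq]
  have hk : IsPlaneChart B (Set.range h) (φ ∘ g) := by
    refine ⟨fun a b hab => hg.2.injective (hφ.injOn ⟨a, rfl⟩ ⟨b, rfl⟩ hab), hr, fun a b => ?_, ?_⟩
    · rw [Function.comp_apply, Function.comp_apply, hφd _ ⟨a, rfl⟩ _ ⟨b, rfl⟩, hg.2.dist_eq]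
    · rw [← hφf, ← hg.2.facets_eq, ← Set.range_comp]
      rfl
  have hfix : ∀ u w, B.FixesClosure (Set.range g) φ (germ g u w) → AgreeAt (φ ∘ g) g u w := by
    rintro u w ⟨Z, hZ, hZf⟩
    obtain ⟨ε, hε, hε'⟩ := mem_germ.1 hZ
    refine ⟨ε, hε, fun z hz hn => hZf _ ⟨⟨_, rfl⟩, fun η hη => ?_⟩⟩
    -- For `z` in the closed cell, `z + δ • w` lies in the cell itself. Taking `δ` small keeps it of
    -- length less than `ε` and within `η` of `z`, which exhibits `g (u + z)` as a limit of points
    -- of `Z`.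
    obtain ⟨δ, hδ, hδ'⟩ : ∃ δ > 0, δ * planeNorm w < min η (ε - planeNorm z) := by
      have hm : 0 < min η (ε - planeNorm z) := lt_min hη (sub_pos.2 hn)
      have hw := planeNorm_nonneg w
      refine ⟨min η (ε - planeNorm z) / (planeNorm w + 1), by positivity, ?_⟩
      rw [div_mul_eq_mul_div, div_lt_iff₀ (by positivity)]
      nlinarith
    refine ⟨g (u + (z + δ • w)), ⟨hε' _ (add_smul_mem_cell hz hδ) ?_, _, rfl⟩, ?_⟩
    · have := planeNorm_add_le z (δ • w)
      rw [planeNorm_smul hδ.le] at this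
      linarith [min_le_right η (ε - planeNorm z)]
    · rw [hg.2.dist_eq, planeNorm_sub_comm, add_sub_add_left_eq_sub, add_sub_cancel_left,
        planeNorm_smul hδ.le]
      exact hδ'.trans_le (min_le_left _ _)
  exact ⟨_, hk.mem hh.1, hr, hfix _ _ f1, hfix _ _ f2⟩

/-! ### Symmetries of the plane -/

/-- Linear isometries preserving the vectorial facets. -/
structure IsPlaneSymm (σ : (ℝ × ℝ) ≃ₗ[ℝ] (ℝ × ℝ)) : Prop where
  norm_map : ∀ z, planeNorm (σ z) = planeNorm z
  mem_cell : ∀ z w, σ z ∈ cell (σ w) ↔ z ∈ cell w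

theorem IsPlaneSymm.trans {σ ρ : (ℝ × ℝ) ≃ₗ[ℝ] (ℝ × ℝ)} (hσ : IsPlaneSymm σ)
    (hρ : IsPlaneSymm ρ) : IsPlaneSymm (σ.trans ρ) :=
  ⟨fun z => (hρ.norm_map _).trans (hσ.norm_map z),
    fun z w => (hρ.mem_cell _ _).trans (hσ.mem_cell z w)⟩

theorem isPlaneSymm_refl : IsPlaneSymm (LinearEquiv.refl ℝ (ℝ × ℝ)) :=
  ⟨fun _ => rfl, fun _ _ => Iff.rfl⟩

theorem IsPlaneSymm.symm {σ : (ℝ × ℝ) ≃ₗ[ℝ] (ℝ × ℝ)} (hσ : IsPlaneSymm σ) :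
    IsPlaneSymm σ.symm :=
  ⟨fun z => by rw [← hσ.norm_map, LinearEquiv.apply_symm_apply],
    fun z w => by rw [← hσ.mem_cell, LinearEquiv.apply_symm_apply, LinearEquiv.apply_symm_apply]⟩

/-- The rotation of angle `π / 3`. -/
noncomputable def rot : (ℝ × ℝ) ≃ₗ[ℝ] (ℝ × ℝ) where
  toFun z := (-z.2, z.1 + z.2)
  invFun z := (z.1 + z.2, -z.1)
  map_add' z w := by ext <;> simp <;> ring
  map_smul' c z := by ext <;> simp; ring
  left_inv z := by ext <;> simp
  right_inv z := by ext <;> simp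

/-- The reflection exchanging the two coordinates. -/
noncomputable def coordFlip : (ℝ × ℝ) ≃ₗ[ℝ] (ℝ × ℝ) := LinearEquiv.prodComm ℝ ℝ ℝ

@[simp] theorem rot_apply (z : ℝ × ℝ) : rot z = (-z.2, z.1 + z.2) := rfl
@[simp] theorem rot_symm_apply (z : ℝ × ℝ) : rot.symm z = (z.1 + z.2, -z.1) := rfl
@[simp] theorem flip_apply (z : ℝ × ℝ) : coordFlip z = (z.2, z.1) := rfl

theorem mem_cell_iff {z w : ℝ × ℝ} : z ∈ cell w ↔ SignType.sign z.1 = SignType.sign w.1 ∧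
    SignType.sign z.2 = SignType.sign w.2 ∧
    SignType.sign (z.1 + z.2) = SignType.sign (w.1 + w.2) := by
  simp [cell, Fin.forall_fin_succ]

theorem isPlaneSymm_rot : IsPlaneSymm rot := by
  refine ⟨fun z => planeNorm_eq_iff.2 (by simp; ring), fun z w => ?_⟩
  rw [mem_cell_iff, mem_cell_iff]
  simp only [rot_apply, Left.sign_neg, neg_inj, neg_add_cancel_comm_assoc]
  tauto

theorem isPlaneSymm_flip : IsPlaneSymm coordFlip := by
  refine ⟨fun z => planeNorm_eq_iff.2 (by simp; ring), fun z w => ?_⟩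
  rw [mem_cell_iff, mem_cell_iff]
  simp only [flip_apply, add_comm z.2, add_comm w.2]
  tauto

theorem isPlaneSymm_neg : IsPlaneSymm (LinearEquiv.neg ℝ) := by
  refine ⟨fun z => planeNorm_neg z, fun z w => ?_⟩
  simp only [LinearEquiv.neg_apply, cell, Set.mem_ofPred_eq, map_neg, Left.sign_neg, neg_inj]

theorem IsPlaneSymm.map_planeGerm {σ : (ℝ × ℝ) ≃ₗ[ℝ] (ℝ × ℝ)} (hσ : IsPlaneSymm σ)
    (a u w : ℝ × ℝ) : Filter.map (fun z => a + σ z) (planeGerm u w) =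
      planeGerm (a + σ u) (σ w) := by
  ext Z
  rw [Filter.mem_map, mem_planeGerm, mem_planeGerm]
  refine exists_congr fun ε => and_congr_right fun _ => ?_
  constructor
  · intro h z hz hn
    have := h (σ.symm z) (by rwa [← hσ.mem_cell, LinearEquiv.apply_symm_apply])
      (by rwa [hσ.symm.norm_map])
    simpa [add_assoc] using this
  · intro h z hz hn
    have := h (σ z) ((hσ.mem_cell _ _).2 hz) (by rwa [hσ.norm_map])
    simpa [add_assoc] using this

/-- Transformations of the plane that can be composed with charts. -/
structure IsPlaneAut (T : ℝ × ℝ → ℝ × ℝ) : Prop where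
  surjective : Function.Surjective T
  dist_eq : ∀ u v, planeNorm (T u - T v) = planeNorm (u - v)
  germs_eq : (Set.range fun p : (ℝ × ℝ) × (ℝ × ℝ) => Filter.map T (planeGerm p.1 p.2)) =
    Set.range fun p : (ℝ × ℝ) × (ℝ × ℝ) => planeGerm p.1 p.2

theorem IsPlaneSymm.isPlaneAut {σ : (ℝ × ℝ) ≃ₗ[ℝ] (ℝ × ℝ)} (hσ : IsPlaneSymm σ)
    (a : ℝ × ℝ) : IsPlaneAut fun z => a + σ z := by
  refine ⟨fun z => ⟨σ.symm (z - a), by simp⟩, fun u v => ?_, ?_⟩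
  · rw [add_sub_add_left_eq_sub, ← map_sub, hσ.norm_map]
  · ext τ
    constructor
    · rintro ⟨⟨u, w⟩, rfl⟩
      exact ⟨(a + σ u, σ w), (hσ.map_planeGerm a u w).symm⟩
    · rintro ⟨⟨u, w⟩, rfl⟩
      refine ⟨(σ.symm (u - a), σ.symm w), ?_⟩
      change Filter.map (fun z => a + σ z) (planeGerm (σ.symm (u - a)) (σ.symm w)) = _
      rw [hσ.map_planeGerm]
      simp

theorem IsPlaneAut.injective {T : ℝ × ℝ → ℝ × ℝ} (hT : IsPlaneAut T) : Function.Injective T := by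
  intro u v h
  have := hT.dist_eq u v
  rw [h, sub_self, planeNorm_zero] at this
  exact sub_eq_zero.1 (planeNorm_eq_zero.1 this.symm)

theorem IsPlaneChart.comp {A : Set X} {g : ℝ × ℝ → X} (hg : IsPlaneChart B A g)
    {T : ℝ × ℝ → ℝ × ℝ} (hT : IsPlaneAut T) : IsPlaneChart B A (g ∘ T) := by
  refine ⟨hg.injective.comp hT.injective, (hT.surjective.range_comp g).trans hg.range_eq,
    fun u v => by rw [Function.comp_apply, Function.comp_apply, hg.dist_eq, hT.dist_eq], ?_⟩
  rw [← hg.facets_eq]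
  have := congrArg (Set.image (Filter.map g)) hT.germs_eq
  rw [← Set.range_comp, ← Set.range_comp] at this
  exact this

theorem mem_planeCharts_comp {g : ℝ × ℝ → X} (hg : g ∈ planeCharts B)
    {σ : (ℝ × ℝ) ≃ₗ[ℝ] (ℝ × ℝ)} (hσ : IsPlaneSymm σ) (a : ℝ × ℝ) :
    (fun z => g (a + σ z)) ∈ planeCharts B :=
  (hg.2.comp (hσ.isPlaneAut a)).mem hg.1

/-- The change of coordinates between two charts of the same apartment. -/
theorem exists_transition {A : Set X} {g k : ℝ × ℝ → X} (hg : IsPlaneChart B A g)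
    (hk : IsPlaneChart B A k) : ∃ T, IsPlaneAut T ∧ k = g ∘ T := by
  have h : ∀ z, ∃ y, g y = k z := fun z => by
    have : k z ∈ Set.range g := by rw [hg.range_eq, ← hk.range_eq]; exact ⟨z, rfl⟩
    exact this
  choose T hT using h
  have hkT : k = g ∘ T := funext fun z => (hT z).symm
  refine ⟨T, ⟨fun y => ?_, fun u v => ?_, ?_⟩, hkT⟩
  · have : g y ∈ Set.range k := by rw [hk.range_eq, ← hg.range_eq]; exact ⟨y, rfl⟩
    obtain ⟨z, hz⟩ := this
    exact ⟨z, hg.injective ((hT z).trans hz)⟩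
  · rw [← hg.dist_eq, hT, hT, hk.dist_eq]
  · apply (Filter.map_injective hg.injective).image_injective
    rw [← Set.range_comp, ← Set.range_comp]
    have := hk.facets_eq.trans hg.facets_eq.symm
    rw [hkT] at this
    exact this

/-! ### The distance and retractions -/

/-- Axiom (B2) for two point facets: the isometry between the apartments fixes both points. Hence
the distance of two points does not depend on the apartment in which it is measured. -/
theorem planeNorm_sub_eq_of_apply_eq (hB : IsAffineBuilding weylA2 B) {g h : ℝ × ℝ → X}
    (hg : g ∈ planeCharts B) (hh : h ∈ planeCharts B) {u v u' v' : ℝ × ℝ}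
    (hu : g u = h u') (hv : g v = h v') : planeNorm (u - v) = planeNorm (u' - v') := by
  obtain ⟨k, hk, hr, k1, k2⟩ := exists_chart_agreeAt hB hg hh (u := u) (w := 0) (u' := v)
    (w' := 0) (mem_germ_zero.2 ⟨u', hu.symm⟩) (mem_germ_zero.2 ⟨v', hv.symm⟩)
  rw [← hh.2.dist_eq u', ← hu, ← hv, ← k1.apply_eq, ← k2.apply_eq, ← hr, hk.2.dist_eq]

open Classical in
/-- The distance of two points of a common apartment. -/
noncomputable def bdist (B : BuildingData X) (p q : X) : ℝ :=
  if h : ∃ c : (ℝ × ℝ → X) × (ℝ × ℝ) × (ℝ × ℝ), c.1 ∈ planeCharts B ∧ c.1 c.2.1 = p ∧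
    c.1 c.2.2 = q then planeNorm (h.choose.2.1 - h.choose.2.2) else 0

theorem bdist_apply (hB : IsAffineBuilding weylA2 B) {g : ℝ × ℝ → X}
    (hg : g ∈ planeCharts B) (u v : ℝ × ℝ) : bdist B (g u) (g v) = planeNorm (u - v) := by
  have h : ∃ c : (ℝ × ℝ → X) × (ℝ × ℝ) × (ℝ × ℝ), c.1 ∈ planeCharts B ∧ c.1 c.2.1 = g u ∧
    c.1 c.2.2 = g v := ⟨(g, u, v), hg, rfl, rfl⟩
  rw [bdist, dif_pos h]
  obtain ⟨h1, h2, h3⟩ := h.choose_spec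
  exact planeNorm_sub_eq_of_apply_eq hB h1 hg h2 h3

/-- The base point lies in the closure of the facet, which the isomorphism of (B2) fixes. -/
theorem apply_mem_range_of_mem_germ (hB : IsAffineBuilding weylA2 B) {g h : ℝ × ℝ → X}
    (hg : g ∈ planeCharts B) (hh : h ∈ planeCharts B) {u w : ℝ × ℝ}
    (h1 : Set.range h ∈ germ g u w) : g u ∈ Set.range h := by
  obtain ⟨k, hk, hr, k1, -⟩ := exists_chart_agreeAt hB hg hh h1 h1
  rw [← hr, ← k1.apply_eq]
  exact ⟨u, rfl⟩

theorem exists_mem_cell_planeNorm_lt (w : ℝ × ℝ) {ε : ℝ} (hε : 0 < ε) :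
    ∃ z ∈ cell w, planeNorm z < ε := by
  have hw0 := planeNorm_nonneg w
  have hδ : 0 < ε / (planeNorm w + 1) := by positivity
  refine ⟨(ε / (planeNorm w + 1)) • w, smul_mem_cell hδ (mem_cell_self w), ?_⟩
  rw [planeNorm_smul hδ.le, div_mul_eq_mul_div, div_lt_iff₀ (by positivity)]
  nlinarith

/-- The difference of the squared distances to `a` and `b` is an affine function of `z`. It vanishes
on a nonempty open set, in particular at two points differing by a positive multiple of `a - b`,
which forces `a = b`. -/
theorem eq_of_planeNorm_sub_eq {a b w : ℝ × ℝ} (hw : Generic w) {ε : ℝ} (hε : 0 < ε)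
    (h : ∀ z ∈ cell w, planeNorm z < ε → planeNorm (a - z) = planeNorm (b - z)) : a = b := by
  have hopen : IsOpen (cell w ∩ {z | planeNorm z < ε}) :=
    (isOpen_cell hw).inter (isOpen_lt continuous_planeNorm continuous_const)
  obtain ⟨z, hz⟩ : (cell w ∩ {z | planeNorm z < ε}).Nonempty :=
    exists_mem_cell_planeNorm_lt w hε
  have ht : Filter.Tendsto (fun η : ℝ => z + η • (a - b)) (𝓝[>] 0) (𝓝 z) := by
    have : Continuous fun η : ℝ => z + η • (a - b) := by fun_prop
    simpa using (this.tendsto 0).mono_left nhdsWithin_le_nhds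
  obtain ⟨η, hη, hη0⟩ := ((ht.eventually (hopen.mem_nhds hz)).and self_mem_nhdsWithin).exists
  have e1 := planeNorm_eq_iff.1 (h z hz.1 hz.2)
  have e2 := planeNorm_eq_iff.1 (h _ hη.1 hη.2)
  have hη0 : 0 < η := hη0
  have hd : planeNorm (a - b) ^ 2 = 0 := by
    rw [planeNorm_sq]
    simp only [Prod.fst_sub, Prod.snd_sub, Prod.fst_add, Prod.snd_add, Prod.smul_fst,
      Prod.smul_snd, smul_eq_mul] at *
    have : η * (6 * ((a.1 - b.1) ^ 2 + (a.1 - b.1) * (a.2 - b.2) + (a.2 - b.2) ^ 2)) = 0 := by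
      linear_combination 3 * e1 - 3 * e2
    exact (mul_eq_zero.1 this).resolve_left hη0.ne'
  exact sub_eq_zero.1 (planeNorm_eq_zero.1 (pow_eq_zero_iff two_ne_zero |>.1 hd))

/-- Charts that agree on the germ of a chamber give the same coordinates to common points. -/
theorem AgreeAt.eq_of_apply_eq (hB : IsAffineBuilding weylA2 B) {g h : ℝ × ℝ → X}
    (hg : g ∈ planeCharts B) (hh : h ∈ planeCharts B) {u w : ℝ × ℝ} (hw : Generic w)
    (ha : AgreeAt g h u w) {a b : ℝ × ℝ} (hab : g a = h b) : a = b := by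
  obtain ⟨ε, hε, ha⟩ := ha
  refine sub_left_injective (b := u) (eq_of_planeNorm_sub_eq hw hε fun z hz hn => ?_)
  change planeNorm (a - u - z) = planeNorm (b - u - z)
  rw [sub_sub, sub_sub]
  exact planeNorm_sub_eq_of_apply_eq hB hg hh hab (ha z (cell_subset_closedCell w hz) hn)

/-- For generic `w` this defines the retraction centred at the chamber germ of `g`: every facet lies
in the image of a chart agreeing with `g` on that germ, and the coordinates read there are unique by
`AgreeAt.eq_of_apply_eq`. -/
theorem exists_agreeAt_mem_germ (hB : IsAffineBuilding weylA2 B) {g h : ℝ × ℝ → X}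
    (hg : g ∈ planeCharts B) (hh : h ∈ planeCharts B) (u w u' w' : ℝ × ℝ) :
    ∃ k ∈ planeCharts B, AgreeAt k g u w ∧ Set.range k ∈ germ h u' w' := by
  obtain ⟨k, hk, k1, k2⟩ := exists_common_chart hB hg hh u w u' w'
  obtain ⟨l, hl, hr, l1, -⟩ := exists_chart_agreeAt hB hg hk k1 k1
  exact ⟨l, hl, l1, hr ▸ k2⟩

/-- The set of `t` in `[0, 1]` where `‖f t - f 0‖ ≤ C * t` contains `0`, is closed because `f` is
continuous, and extends to the right of each of its points, hence is everything. -/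
theorem norm_sub_le_of_locally {V : Type*} [NormedAddCommGroup V] {f : ℝ → V} {C : ℝ}
    (h : ∀ t, ∃ ε > 0, ∀ s, |s - t| < ε → ‖f s - f t‖ ≤ C * |s - t|) : ‖f 1 - f 0‖ ≤ C := by
  have hc : Continuous f := by
    rw [continuous_iff_continuousAt]
    intro t
    obtain ⟨ε, hε, ht⟩ := h t
    rw [ContinuousAt, tendsto_iff_norm_sub_tendsto_zero]
    have hl : Filter.Tendsto (fun s : ℝ => C * |s - t|) (𝓝 t) (𝓝 0) := by
      have : Continuous fun s : ℝ => C * |s - t| := by fun_prop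
      simpa using this.tendsto t
    refine squeeze_zero' (Filter.Eventually.of_forall fun _ => norm_nonneg _) ?_ hl
    filter_upwards [Metric.ball_mem_nhds t hε] with s hs
    exact ht s hs
  have hs := IsClosed.Icc_subset_of_forall_mem_nhdsWithin (a := (0 : ℝ)) (b := 1)
    (s := {t | ‖f t - f 0‖ ≤ C * t})
    ((isClosed_le (by fun_prop) (by fun_prop)).inter isClosed_Icc) (by simp) ?_
  · simpa using hs (Set.right_mem_Icc.2 zero_le_one)
  · rintro t ⟨ht, -⟩
    obtain ⟨ε, hε, hε'⟩ := h t
    filter_upwards [Ioo_mem_nhdsGT (lt_add_of_pos_right t hε)] with s hs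
    have h1 : |s - t| = s - t := abs_of_pos (sub_pos.2 hs.1)
    have h2 := hε' s (by rw [h1]; linarith [hs.2])
    have h3 : ‖f t - f 0‖ ≤ C * t := ht
    have h4 := norm_sub_le_norm_sub_add_norm_sub (f s) (f t) (f 0)
    rw [h1] at h2
    change ‖f s - f 0‖ ≤ C * s
    linarith

/-- The retraction onto an apartment centred at the germ of a chamber does not increase the
distances. -/
theorem planeNorm_sub_le_of_agreeAt (hB : IsAffineBuilding weylA2 B) {g₀ g g' h : ℝ × ℝ → X}
    (hg₀ : g₀ ∈ planeCharts B) (hg : g ∈ planeCharts B) (hg' : g' ∈ planeCharts B)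
    (hh : h ∈ planeCharts B) {u₀ w₀ : ℝ × ℝ} (hw₀ : Generic w₀) (ha : AgreeAt g g₀ u₀ w₀)
    (ha' : AgreeAt g' g₀ u₀ w₀) {u v u' v' : ℝ × ℝ} (hu : g u' = h u) (hv : g' v' = h v) :
    planeNorm (u' - v') ≤ planeNorm (u - v) := by
  -- The path `ρ` chosen below is the image under the retraction of the segment of `h` from `u` to
  -- `v`.
  have hex : ∀ t : ℝ, ∃ y, ∃ k ∈ planeCharts B, AgreeAt k g₀ u₀ w₀ ∧ k y = h (u + t • (v - u)) := by
    intro t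
    obtain ⟨k, hk, k1, k2⟩ := exists_agreeAt_mem_germ hB hg₀ hh u₀ w₀ (u + t • (v - u)) 0
    obtain ⟨y, hy⟩ := mem_germ_zero.1 k2
    exact ⟨y, k, hk, k1, hy⟩
  choose ρ hρ using hex
  have hρ' : ∀ t y, (∃ k ∈ planeCharts B, AgreeAt k g₀ u₀ w₀ ∧ k y = h (u + t • (v - u))) →
      ρ t = y := by
    rintro t y ⟨k, hk, k1, k2⟩
    obtain ⟨l, hl, l1, l2⟩ := hρ t
    exact (l1.trans k1.symm).eq_of_apply_eq hB hl hk hw₀ (l2.trans k2.symm)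
  have hN := planeNorm_nonneg (v - u)
  -- One apartment contains both the central chamber germ and the germ of the segment on a given
  -- side of the time `t`. The retraction is isometric there, so `ρ` has constant speed near `t` on
  -- each side.
  have side : ∀ (t : ℝ) (w : ℝ × ℝ), ∃ ε > 0, ∀ s δ : ℝ, 0 ≤ δ → δ < ε →
      s • (v - u) = t • (v - u) + δ • w → planeNorm (ρ s - ρ t) = δ * planeNorm w := by
    intro t w
    obtain ⟨k, hk, k1, k2⟩ := exists_agreeAt_mem_germ hB hg₀ hh u₀ w₀ (u + t • (v - u)) w
    obtain ⟨y, hy⟩ := apply_mem_range_of_mem_germ hB hh hk k2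
    obtain ⟨ε, hε, hε'⟩ := mem_germ.1 k2
    have hNw := planeNorm_nonneg w
    refine ⟨ε / (planeNorm w + 1), by positivity, fun s δ hδ0 hδ hs => ?_⟩
    rcases hδ0.eq_or_lt with rfl | hδ0
    · have : h (u + s • (v - u)) = h (u + t • (v - u)) := by rw [hs]; simp
      rw [hρ' s y ⟨k, hk, k1, hy.trans this.symm⟩, hρ' t y ⟨k, hk, k1, hy⟩]
      simp [planeNorm_zero]
    · obtain ⟨x, hx⟩ := hε' (δ • w) (smul_mem_cell hδ0 (mem_cell_self w)) (by
        rw [planeNorm_smul hδ0.le]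
        rw [lt_div_iff₀ (by positivity)] at hδ
        nlinarith)
      have hx' : k x = h (u + s • (v - u)) := by rw [hx, hs, add_assoc]
      rw [hρ' s x ⟨k, hk, k1, hx'⟩, hρ' t y ⟨k, hk, k1, hy⟩,
        planeNorm_sub_eq_of_apply_eq hB hk hh hx' hy, hs, ← planeNorm_smul hδ0.le]
      congr 1
      abel
  have hloc : ‖coordA2 (ρ 1) - coordA2 (ρ 0)‖ ≤ planeNorm (v - u) := by
    refine norm_sub_le_of_locally (f := fun t => coordA2 (ρ t)) fun t => ?_
    obtain ⟨ε, hε, h1⟩ := side t (v - u)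
    obtain ⟨ε', hε', h2⟩ := side t (-(v - u))
    refine ⟨min ε ε', lt_min hε hε', fun s hs => ?_⟩
    rw [← map_sub]
    change planeNorm _ ≤ _
    rcases le_total t s with hts | hts
    · rw [abs_of_nonneg (sub_nonneg.2 hts)] at hs ⊢
      rw [h1 s (s - t) (sub_nonneg.2 hts) (hs.trans_le (min_le_left _ _)) (by module), mul_comm]
    · rw [abs_of_nonpos (sub_nonpos.2 hts)] at hs ⊢
      rw [h2 s (-(s - t)) (by linarith) (hs.trans_le (min_le_right _ _)) (by module),
        planeNorm_neg, mul_comm]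
  rw [← map_sub] at hloc
  change planeNorm _ ≤ _ at hloc
  rw [hρ' 1 v' ⟨g', hg', ha', by rw [hv]; congr 1; module⟩,
    hρ' 0 u' ⟨g, hg, ha, by rw [hu]; congr 1; module⟩] at hloc
  rwa [planeNorm_sub_comm u', planeNorm_sub_comm u]

/-- A point between two points of an apartment lies on the segment joining them. -/
theorem eq_of_between (hB : IsAffineBuilding weylA2 B) {g h : ℝ × ℝ → X}
    (hg : g ∈ planeCharts B) (hh : h ∈ planeCharts B) {u v y : ℝ × ℝ} {r : ℝ} (hr : 0 ≤ r)
    (hr1 : r ≤ 1) (h1 : bdist B (g u) (h y) ≤ r * planeNorm (v - u))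
    (h2 : bdist B (h y) (g v) ≤ (1 - r) * planeNorm (v - u)) : h y = g (u + r • (v - u)) := by
  -- The centre of the retraction is placed at the expected point. The image `a` of `h y` satisfies
  -- both distance bounds, so strict convexity identifies it with that point, and there `k` and `g`
  -- agree.
  obtain ⟨k, hk, k1, k2⟩ := exists_agreeAt_mem_germ hB hg hh (u + r • (v - u)) (1, 1) y 0
  obtain ⟨a, ha⟩ := mem_germ_zero.1 k2
  have key : ∀ x, planeNorm (x - a) ≤ bdist B (g x) (h y) ∧
      planeNorm (a - x) ≤ bdist B (h y) (g x) := by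
    intro x
    obtain ⟨l, hl, l1, l2⟩ := exists_common_chart hB hg hh x 0 y 0
    obtain ⟨b, hb⟩ := mem_germ_zero.1 l1
    obtain ⟨c, hc⟩ := mem_germ_zero.1 l2
    have := planeNorm_sub_le_of_agreeAt hB hg hg hk hl generic_one_one (AgreeAt.refl g _ _) k1
      (u := b) (v := c) hb.symm (ha.trans hc.symm)
    rw [← hb, ← hc, bdist_apply hB hl, bdist_apply hB hl, planeNorm_sub_comm a,
      planeNorm_sub_comm c]
    exact ⟨this, this⟩
  have h3 := planeNorm_convexity (m := a - u) (v := v - u) hr hr1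
    (by rw [planeNorm_sub_comm]; exact (key u).1.trans h1)
    (by rw [sub_sub_sub_cancel_right, planeNorm_sub_comm]; exact (key v).2.trans h2)
  rw [← ha, ← k1.apply_eq, ← h3, add_sub_cancel]

/-! ### Convexity of the intersections of apartments -/

/-- Uniqueness of geodesics: the point of the segment in `h` has the right distances to both ends,
so `eq_of_between` locates it on the segment in `g`. -/
theorem apply_segment_eq (hB : IsAffineBuilding weylA2 B) {g h : ℝ × ℝ → X}
    (hg : g ∈ planeCharts B) (hh : h ∈ planeCharts B) {u v u' v' : ℝ × ℝ} (hu : g u = h u')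
    (hv : g v = h v') {r : ℝ} (hr : 0 ≤ r) (hr1 : r ≤ 1) :
    g (u + r • (v - u)) = h (u' + r • (v' - u')) := by
  have hd := planeNorm_sub_eq_of_apply_eq hB hg hh hv hu
  symm
  refine eq_of_between hB hg hh hr hr1 ?_ ?_
  · rw [hu, bdist_apply hB hh, sub_add_cancel_left, planeNorm_neg, planeNorm_smul hr, hd]
  · rw [hv, bdist_apply hB hh, planeNorm_sub_comm, hd, ← planeNorm_smul (sub_nonneg.2 hr1)]
    apply le_of_eq
    congr 1
    module

/-- The intersection of two apartments is convex. -/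
theorem convex_preimage_range (hB : IsAffineBuilding weylA2 B) {g h : ℝ × ℝ → X}
    (hg : g ∈ planeCharts B) (hh : h ∈ planeCharts B) : Convex ℝ (g ⁻¹' Set.range h) := by
  rintro u ⟨u', hu⟩ v ⟨v', hv⟩ a b ha hb hab
  refine ⟨_, (apply_segment_eq hB hg hh hu.symm hv.symm hb (by linarith)).symm.trans ?_⟩
  congr 1
  obtain rfl : a = 1 - b := by linarith
  module

theorem segment_mem_range (hB : IsAffineBuilding weylA2 B) {g h : ℝ × ℝ → X}
    (hg : g ∈ planeCharts B) (hh : h ∈ planeCharts B) {u v y : ℝ × ℝ} {r : ℝ} (hr : 0 ≤ r)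
    (hr1 : r ≤ 1) (hy : y = u + r • (v - u)) (hu : g u ∈ Set.range h)
    (hv : g v ∈ Set.range h) : g y ∈ Set.range h := by
  have := convex_preimage_range hB hg hh (x := u) hu (y := v) hv (sub_nonneg.2 hr1) hr (by ring)
  rwa [show (1 - r) • u + r • v = y by rw [hy]; module] at this

theorem planeGerm_le_nhds (u w : ℝ × ℝ) : planeGerm u w ≤ 𝓝 u := by
  have : Continuous fun z : ℝ × ℝ => u + z := by fun_prop
  have h := this.tendsto 0
  rw [add_zero] at h
  exact h.mono_left nhdsWithin_le_nhds

theorem vadd_cell_mem_planeGerm (u w : ℝ × ℝ) : {x | x - u ∈ cell w} ∈ planeGerm u w :=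
  mem_planeGerm.2 ⟨1, one_pos, fun z hz _ => by simpa using hz⟩

theorem eq_of_inf_planeGerm_neBot {u w u' w' : ℝ × ℝ}
    (h : (planeGerm u w ⊓ planeGerm u' w').NeBot) : u = u' ∧ cell w = cell w' := by
  have hu : u = u' := by
    have : (𝓝 u ⊓ 𝓝 u').NeBot :=
      h.mono (inf_le_inf (planeGerm_le_nhds u w) (planeGerm_le_nhds u' w'))
    exact eq_of_nhds_neBot this
  subst hu
  obtain ⟨x, hx, hx'⟩ := h.nonempty_of_mem (Filter.inter_mem_inf (vadd_cell_mem_planeGerm u w)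
    (vadd_cell_mem_planeGerm u w'))
  exact ⟨rfl, (cell_eq_of_mem hx).symm.trans (cell_eq_of_mem hx')⟩

/-- Two facets that contain the germ of a common segment are equal. -/
theorem germ_eq_of_le (hB : IsAffineBuilding weylA2 B) {g h : ℝ × ℝ → X}
    (hg : g ∈ planeCharts B) (hh : h ∈ planeCharts B) {u w u' w' : ℝ × ℝ} {l : Filter X}
    [l.NeBot] (h1 : l ≤ germ g u w) (h2 : l ≤ germ h u' w') : germ g u w = germ h u' w' := by
  -- Inside one apartment, two facet germs bounding a common proper filter have the same base point
  -- and the same cell.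
  obtain ⟨k, hk, k1, k2⟩ := exists_common_chart hB hg hh u w u' w'
  obtain ⟨a, b, e1⟩ := exists_eq_germ hk.2 (germ_mem_facets hg u w) k1
  obtain ⟨a', b', e2⟩ := exists_eq_germ hk.2 (germ_mem_facets hh u' w') k2
  rw [e1] at h1 ⊢
  rw [e2] at h2 ⊢
  have h3 : (germ k a b ⊓ germ k a' b').NeBot := Filter.NeBot.mono ‹_› (le_inf h1 h2)
  rw [germ, germ, ← Filter.map_inf hk.2.injective] at h3
  obtain ⟨rfl, h4⟩ := eq_of_inf_planeGerm_neBot (Filter.NeBot.of_map h3)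
  rw [germ, germ, planeGerm, planeGerm, h4]

theorem map_ray_le_germ (g : ℝ × ℝ → X) (u w : ℝ × ℝ) :
    Filter.map (fun r : ℝ => g (u + r • w)) (𝓝[>] 0) ≤ germ g u w := by
  intro Z hZ
  obtain ⟨ε, hε, h⟩ := mem_germ.1 hZ
  have hw := planeNorm_nonneg w
  rw [Filter.mem_map]
  filter_upwards [Ioo_mem_nhdsGT (show 0 < ε / (planeNorm w + 1) by positivity)] with r hr
  refine h _ (smul_mem_cell hr.1 (mem_cell_self w)) ?_
  rw [planeNorm_smul hr.1.le]
  have := (lt_div_iff₀ (by positivity)).1 hr.2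
  nlinarith [hr.1]

/-- An apartment containing a segment contains the facet germ of this segment at its origin. -/
theorem range_mem_germ_of_mem (hB : IsAffineBuilding weylA2 B) {g h : ℝ × ℝ → X}
    (hg : g ∈ planeCharts B) (hh : h ∈ planeCharts B) {u w : ℝ × ℝ} (h1 : g u ∈ Set.range h)
    (h2 : g (u + w) ∈ Set.range h) : Set.range h ∈ germ g u w := by
  obtain ⟨u', hu⟩ := h1
  obtain ⟨v', hv⟩ := h2
  -- The segment read in `g` and the same segment read in `h` coincide pointwise, so its germ at the
  -- origin lies in a facet of each apartment.
  have hle : Filter.map (fun r : ℝ => g (u + r • w)) (𝓝[>] 0) ≤ germ h u' (v' - u') := by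
    refine le_trans (le_of_eq (Filter.map_congr ?_)) (map_ray_le_germ h u' (v' - u'))
    filter_upwards [Ioo_mem_nhdsGT one_pos] with r hr
    have := apply_segment_eq hB hg hh hu.symm hv.symm hr.1.le hr.2.le
    rwa [add_sub_cancel_left] at this
  rw [germ_eq_of_le hB hg hh (map_ray_le_germ g u w) hle]
  exact range_mem_germ _ _ _

theorem cell_of_pos {a b : ℝ} (ha : 0 < a) (hb : 0 < b) : cell (a, b) = cell (1, 1) := by
  refine cell_eq_of_mem (mem_cell_iff.2 ?_)
  simp [sign_pos, ha, hb, add_pos]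

/-- Let `c` be the supremum of the abscissas reached in `h` along the first axis. It is attained,
because an apartment containing a facet contains its base point. If `c < a`, the segment from there
to `u + (a, b)` has generic direction, so the intersection contains a chamber germ and hence its
closure, which extends along the axis beyond `c`. -/
theorem corner_mem_range (hB : IsAffineBuilding weylA2 B) {g h : ℝ × ℝ → X}
    (hg : g ∈ planeCharts B) (hh : h ∈ planeCharts B) {u : ℝ × ℝ} {a b : ℝ} (ha : 0 < a)
    (hb : 0 < b) (h1 : g u ∈ Set.range h) (h2 : g (u + (a, b)) ∈ Set.range h) :
    g (u + (a, 0)) ∈ Set.range h := by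
  set S : Set ℝ := {s | s ∈ Set.Icc 0 a ∧ g (u + (s, 0)) ∈ Set.range h} with hS
  have h0 : (0 : ℝ) ∈ S := ⟨⟨le_rfl, ha.le⟩, by
    rw [show u + ((0 : ℝ), (0 : ℝ)) = u from add_zero u]; exact h1⟩
  have hbdd : BddAbove S := ⟨a, fun s hs => hs.1.2⟩
  set c := sSup S with hc
  have hc0 : 0 ≤ c := le_csSup hbdd h0
  have hca : c ≤ a := csSup_le ⟨0, h0⟩ fun s hs => hs.1.2
  have hlt : ∀ s, 0 ≤ s → s < c → g (u + (s, 0)) ∈ Set.range h := by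
    intro s hs hsc
    obtain ⟨t, ht, hst⟩ := exists_lt_of_lt_csSup ⟨0, h0⟩ hsc
    have ht0 : 0 < t := hs.trans_lt hst
    exact segment_mem_range hB hg hh (r := s / t) (by positivity) ((div_le_one ht0).2 hst.le)
      (by ext <;> simp [ht0.ne']) h1 ht.2
  have hcS : g (u + (c, 0)) ∈ Set.range h := by
    rcases hc0.eq_or_lt with h' | hc0
    · rw [← h']; exact h0.2
    · refine apply_mem_range_of_mem_germ hB hg hh (w := (-1, 0))
        (mem_germ.2 ⟨c, hc0, fun z hz hn => ?_⟩)
      have hz' := mem_cell_iff.1 hz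
      have hz1 : z.1 < 0 := by
        have := hz'.1
        rwa [sign_neg (show ((-1 : ℝ), (0 : ℝ)).1 < 0 by norm_num), sign_eq_neg_one_iff] at this
      have hz2 : z.2 = 0 := by
        have := hz'.2.1
        rwa [sign_zero, sign_eq_zero_iff] at this
      have hn2 : planeNorm z ^ 2 < c ^ 2 := pow_lt_pow_left₀ hn (planeNorm_nonneg z) two_ne_zero
      rw [planeNorm_sq, hz2] at hn2
      have hcz : - c < z.1 := by nlinarith
      have := hlt (c + z.1) (by linarith) (by linarith)
      convert this using 2
      ext <;> simp [hz2, add_assoc]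
  rcases hca.eq_or_lt with h' | hca
  · rwa [h'] at hcS
  · exfalso
    have hm := range_mem_germ_of_mem hB hg hh (u := u + (c, 0)) (w := (a - c, b)) hcS (by
      convert h2 using 2
      ext <;> simp)
    obtain ⟨k, hk, hr, ⟨ε, hε, hk1⟩, -⟩ := exists_chart_agreeAt hB hg hh hm hm
    -- The squared length of `(d, 0)` is `6 d²`, which is less than `ε²` when `d < ε / 3`.
    obtain ⟨d, hd0, hd⟩ : ∃ d > 0, d < min (a - c) (ε / 3) :=
      exists_between (lt_min (sub_pos.2 hca) (by positivity))
    have hd1 := hd.trans_le (min_le_left _ _)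
    have hd2 := hd.trans_le (min_le_right _ _)
    have := hk1 (d, 0) (by
      rw [← closure_cell, cell_of_pos (sub_pos.2 hca) hb, closure_cell, mem_closedCell_one_one]
      exact ⟨hd0.le, le_rfl⟩) (by
      refine lt_of_pow_lt_pow_left₀ 2 hε.le ?_
      rw [planeNorm_sq]
      nlinarith)
    have hcd : c + d ∈ S := by
      refine ⟨⟨by linarith, by linarith⟩, ?_⟩
      rw [← hr, show u + (c + d, (0 : ℝ)) = u + (c, 0) + (d, 0) by ext <;> simp [add_assoc], ← this]
      exact ⟨_, rfl⟩
    linarith [le_csSup hbdd hcd]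

/-- The intersection of two apartments contains, with two points, the parallelogram bounded by
walls which they span. -/
theorem parallelogram_subset_range (hB : IsAffineBuilding weylA2 B) {g h : ℝ × ℝ → X}
    (hg : g ∈ planeCharts B) (hh : h ∈ planeCharts B) {u : ℝ × ℝ} {a b : ℝ} (ha : 0 < a)
    (hb : 0 < b) (h1 : g u ∈ Set.range h) (h2 : g (u + (a, b)) ∈ Set.range h) {s t : ℝ}
    (hs : 0 ≤ s) (hsa : s ≤ a) (ht : 0 ≤ t) (htb : t ≤ b) : g (u + (s, t)) ∈ Set.range h := by
  have c1 := corner_mem_range hB hg hh ha hb h1 h2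
  have c2 := corner_mem_range hB (mem_planeCharts_comp hg isPlaneSymm_flip 0) hh
    (u := coordFlip u) (a := b) (b := a) hb ha 
    (by rw [zero_add]; exact h1) (by rw [zero_add, map_add]; exact h2)
  rw [zero_add, map_add, flip_apply, flip_apply, flip_apply] at c2
  have hsa' : s / a ≤ 1 := (div_le_one ha).2 hsa
  have htb' : t / b ≤ 1 := (div_le_one hb).2 htb
  have d1 : g (u + (s, 0)) ∈ Set.range h :=
    segment_mem_range hB hg hh (r := s / a) (by positivity) hsa'
      (by ext <;> simp [ha.ne']) h1 c1
  have d2 : g (u + (s, b)) ∈ Set.range h :=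
    segment_mem_range hB hg hh (r := s / a) (by positivity) hsa'
      (by ext <;> simp [ha.ne']) c2 h2
  exact segment_mem_range hB hg hh (r := t / b) (by positivity) htb'
    (by ext <;> simp [hb.ne']) d1 d2

/-! ### Opposite chambers -/

theorem planeNorm_le (z : ℝ × ℝ) : planeNorm z ≤ 3 * (|z.1| + |z.2|) := by
  refine (sq_le_sq₀ (planeNorm_nonneg z) (by positivity)).1 ?_
  rw [planeNorm_sq, ← sq_abs z.1, ← sq_abs z.2]
  have h1 : z.1 * z.2 ≤ |z.1| * |z.2| := by rw [← abs_mul]; exact le_abs_self _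
  nlinarith [mul_nonneg (abs_nonneg z.1) (abs_nonneg z.2), sq_nonneg |z.1|, sq_nonneg |z.2|]

theorem mem_closedCell_neg_one_neg_one {z : ℝ × ℝ} :
    z ∈ closedCell (-1, -1) ↔ z.1 ≤ 0 ∧ z.2 ≤ 0 := by
  simp only [closedCell, Set.mem_ofPred_eq, Fin.forall_fin_succ]
  norm_num
  exact fun h1 h2 => by nlinarith

theorem generic_neg_one_neg_one : Generic (-1, -1) := by
  have := generic_neg generic_one_one
  simpa using this

theorem cell_of_neg {a b : ℝ} (ha : a < 0) (hb : b < 0) : cell (a, b) = cell (-1, -1) := by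
  refine cell_eq_of_mem (mem_cell_iff.2 ?_)
  have h : (-1 : ℝ) + -1 < 0 := by norm_num
  simp [sign_neg, ha, hb, add_neg, h]

theorem germ_congr_cell (g : ℝ × ℝ → X) (u : ℝ × ℝ) {w w' : ℝ × ℝ} (h : cell w = cell w') :
    germ g u w = germ g u w' := by
  rw [germ, germ, planeGerm, planeGerm, h]

theorem exists_forall_closedCell_mem_range (hB : IsAffineBuilding weylA2 B) {g h : ℝ × ℝ → X}
    (hg : g ∈ planeCharts B) (hh : h ∈ planeCharts B) {u w : ℝ × ℝ}
    (h1 : Set.range h ∈ germ g u w) :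
    ∃ ε > 0, ∀ z ∈ closedCell w, planeNorm z < ε → g (u + z) ∈ Set.range h := by
  obtain ⟨k, hk, hr, ⟨ε, hε, k1⟩, -⟩ := exists_chart_agreeAt hB hg hh h1 h1
  exact ⟨ε, hε, fun z hz hn => by rw [← k1 z hz hn, ← hr]; exact ⟨_, rfl⟩⟩

/-- A vertex of a regular hexagon centred at the origin has two neighbours. -/
theorem hexagon {t : ℝ} (ht : 0 < t) {σ : (ℝ × ℝ) ≃ₗ[ℝ] (ℝ × ℝ)} (hσ : IsPlaneSymm σ)
    {z : ℝ × ℝ} (h1 : planeNorm z = planeNorm (0, t))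
    (h2 : planeNorm (z - σ (0, t)) = planeNorm (0, t)) : z = σ (t, 0) ∨ z = σ (-t, t) := by
  obtain ⟨y, rfl⟩ := σ.surjective z
  rw [hσ.norm_map] at h1
  rw [← map_sub, hσ.norm_map] at h2
  rw [planeNorm_eq_iff] at h1 h2
  simp only [Prod.fst_sub, Prod.snd_sub] at h1 h2
  have h3 : y.1 = t - 2 * y.2 := by
    have : t * (y.1 - (t - 2 * y.2)) = 0 := by linear_combination h1 - h2
    exact sub_eq_zero.1 ((mul_eq_zero.1 this).resolve_left ht.ne')
  have h4 : y.2 * (y.2 - t) = 0 := by rw [h3] at h1; linear_combination h1 / 3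
  rcases mul_eq_zero.1 h4 with h5 | h5
  · left; congr 1; ext
    · rw [h3, h5]; simp
    · exact h5
  · right; congr 1
    have h6 := sub_eq_zero.1 h5
    ext
    · rw [h3, h6]; simp; ring
    · exact h6

/-- A gallery of four chambers at a point, two consecutive chambers being distinct and the three
panels being consecutively distinct, has opposite extremities. -/
theorem exists_opposite (hB : IsAffineBuilding weylA2 B) {g₁ g₂ g₃ g₄ : ℝ × ℝ → X}
    (hg₁ : g₁ ∈ planeCharts B) (hg₂ : g₂ ∈ planeCharts B) (hg₃ : g₃ ∈ planeCharts B)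
    (hg₄ : g₄ ∈ planeCharts B) (h12 : ∀ t, 0 ≤ t → g₁ (0, t) = g₂ (t, 0))
    (h23 : ∀ t, 0 ≤ t → g₂ (0, t) = g₃ (t, 0)) (h34 : ∀ t, 0 ≤ t → g₃ (0, t) = g₄ (t, 0))
    (n12 : ∀ t, 0 < t → g₁ (t, 0) ≠ g₂ (0, t)) (n23 : ∀ t, 0 < t → g₂ (t, 0) ≠ g₃ (0, t))
    (n34 : ∀ t, 0 < t → g₃ (t, 0) ≠ g₄ (0, t)) :
    ∃ k ∈ planeCharts B, AgreeAt k g₁ 0 (1, 1) ∧ AgreeAt k (fun z => g₄ (-z)) 0 (-1, -1) := by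
  -- The apartment of `h` carries the two middle chambers, that of `k` the two extreme ones; the
  -- middle panel will be transferred from the first to the second.
  obtain ⟨h, hh, ⟨ε₁, hε₁, h1⟩, h2⟩ := exists_agreeAt_mem_germ hB hg₂ hg₃ 0 (1, 1) 0 (1, 1)
  obtain ⟨ε₂, hε₂, h2⟩ := exists_forall_closedCell_mem_range hB hg₃ hh h2
  obtain ⟨k, hk, hk1, k2⟩ := exists_agreeAt_mem_germ hB hg₁ hg₄ 0 (1, 1) 0 (1, 1)
  obtain ⟨ε₃, hε₃, k1⟩ := hk1
  obtain ⟨ε₄, hε₄, k2⟩ := exists_forall_closedCell_mem_range hB hg₄ hk k2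
  -- Points of the half axes with parameter below `2 * η` have length below `6 * η`. The factor two
  -- leaves room for the parameter `2 * t`, which is needed to obtain a point as a midpoint.
  obtain ⟨η, hη, hη'⟩ : ∃ η > 0, 6 * η < min (min ε₁ ε₂) (min ε₃ ε₄) :=
    ⟨min (min ε₁ ε₂) (min ε₃ ε₄) / 7, by positivity, by
      have : 0 < min (min ε₁ ε₂) (min ε₃ ε₄) := by positivity
      linarith⟩
  have l1 : 6 * η < ε₁ := hη'.trans_le ((min_le_left _ _).trans (min_le_left _ _))
  have l2 : 6 * η < ε₂ := hη'.trans_le ((min_le_left _ _).trans (min_le_right _ _))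
  have l3 : 6 * η < ε₃ := hη'.trans_le ((min_le_right _ _).trans (min_le_left _ _))
  have l4 : 6 * η < ε₄ := hη'.trans_le ((min_le_right _ _).trans (min_le_right _ _))
  have na : ∀ t, 0 ≤ t → t < 2 * η → planeNorm (t, 0) < 6 * η := fun t ht0 ht => by
    have := planeNorm_le (t, 0)
    simp only [abs_of_nonneg ht0, abs_zero] at this
    linarith
  have nb : ∀ t, 0 ≤ t → t < 2 * η → planeNorm (0, t) < 6 * η := fun t ht0 ht => by
    have := planeNorm_le (0, t)
    simp only [abs_of_nonneg ht0, abs_zero] at this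
    linarith
  have ma : ∀ t : ℝ, 0 ≤ t → (t, (0 : ℝ)) ∈ closedCell (1, 1) := fun t ht =>
    mem_closedCell_one_one.2 ⟨ht, le_rfl⟩
  have mb : ∀ t : ℝ, 0 ≤ t → ((0 : ℝ), t) ∈ closedCell (1, 1) := fun t ht =>
    mem_closedCell_one_one.2 ⟨le_rfl, ht⟩
  simp only [zero_add] at h1 h2 k1 k2
  have nab' : ∀ t : ℝ, planeNorm ((0, t) - (t, 0)) = planeNorm (0, t) := fun t =>
    planeNorm_eq_iff.2 (by simp only [Prod.fst_sub, Prod.snd_sub]; ring)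
  have b23 : g₂ 0 = g₃ 0 := h23 0 le_rfl
  have b12 : g₁ 0 = g₂ 0 := h12 0 le_rfl
  have b34 : g₃ 0 = g₄ 0 := h34 0 le_rfl
  have bh : h 0 = g₂ 0 := h1 0 (zero_mem_closedCell _) (by rwa [planeNorm_zero])
  have bk : k 0 = g₁ 0 := k1 0 (zero_mem_closedCell _) (by rwa [planeNorm_zero])
  -- In `h` the point `g₃ (0, t)` forms an equilateral triangle with the centre and `g₂ (0, t)`. One
  -- of the two candidates is `g₂ (t, 0)`, excluded since the gallery does not backtrack.
  have e1 : ∀ t, 0 < t → t < 2 * η → h (-t, t) = g₃ (0, t) := by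
    intro t ht ht'
    obtain ⟨z, hz⟩ := h2 _ (mb t ht.le) ((nb t ht.le ht').trans l2)
    have h3 := h1 _ (mb t ht.le) ((nb t ht.le ht').trans l1)
    have z1 := planeNorm_sub_eq_of_apply_eq hB hh hg₃ hz (bh.trans b23)
    have z2 := planeNorm_sub_eq_of_apply_eq hB hh hg₃ hz (h3.trans (h23 t ht.le))
    rw [sub_zero, sub_zero] at z1
    rw [nab'] at z2
    rcases hexagon ht isPlaneSymm_refl z1 z2 with rfl | rfl
    · refine absurd ?_ (n23 t ht)
      rw [← hz]
      exact (h1 _ (ma t ht.le) ((na t ht.le ht').trans l1)).symm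
    · exact hz
  have e2 : ∀ t, 0 < t → t < η → k (-t, 0) = g₄ (t, 0) ∧ k (0, -t) = g₄ (0, t) := by
    intro t ht ht'
    have ht2 : t < 2 * η := by linarith
    have hk4 : ∀ s, 0 ≤ s → s < 2 * η → g₄ (s, 0) ∈ Set.range k := fun s hs hs' =>
      k2 _ (ma s hs) ((na s hs hs').trans l4)
    have hk1a : ∀ s, 0 ≤ s → s < 2 * η → k (s, 0) = g₁ (s, 0) := fun s hs hs' =>
      k1 _ (ma s hs) ((na s hs hs').trans l3)
    have hk1b : ∀ s, 0 ≤ s → s < 2 * η → k (0, s) = g₂ (s, 0) := fun s hs hs' =>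
      (k1 _ (mb s hs) ((nb s hs hs').trans l3)).trans (h12 s hs)
    -- In `h` this point is the midpoint of `g₂ (2 * t, 0)` and `g₃ (0, 2 * t)`. These lie on panels
    -- of the first and last chambers, hence in `k`, and convexity applies.
    have hmem : g₂ (0, t) ∈ Set.range k := by
      rw [← h1 _ (mb t ht.le) ((nb t ht.le ht2).trans l1)]
      refine segment_mem_range hB hh hk (u := (2 * t, 0)) (v := (-(2 * t), 2 * t)) (r := 1 / 2)
        (by norm_num) (by norm_num) (by ext <;> simp; ring) ?_ ?_
      · rw [h1 _ (ma _ (by linarith)) ((na _ (by linarith) (by linarith)).trans l1),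
          ← hk1b _ (by linarith) (by linarith)]
        exact ⟨_, rfl⟩
      · rw [e1 _ (by linarith) (by linarith), h34 _ (by linarith)]
        exact hk4 _ (by linarith) (by linarith)
    obtain ⟨z₃, hz₃⟩ := hmem
    have a1 := planeNorm_sub_eq_of_apply_eq hB hk hg₂ hz₃ (bk.trans b12)
    have a2 := planeNorm_sub_eq_of_apply_eq hB hk hg₂ hz₃ (hk1b t ht.le ht2)
    rw [sub_zero, sub_zero] at a1
    rw [nab'] at a2
    -- From here on the hexagon of radius `t` in `k` is followed vertex by vertex, the absence of
    -- backtracking excluding the vertex already visited.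
    have c3 : k (-t, t) = g₂ (0, t) := by
      rcases hexagon ht isPlaneSymm_refl a1 a2 with rfl | rfl
      · exact absurd ((hk1a t ht.le ht2).symm.trans hz₃) (n12 t ht)
      · exact hz₃
    obtain ⟨z₄, hz₄⟩ := hk4 t ht.le ht2
    have c3' := c3.trans (h23 t ht.le)
    have hz₄' := hz₄.trans (h34 t ht.le).symm
    have a3 := planeNorm_sub_eq_of_apply_eq hB hk hg₃ hz₄' (bk.trans (b12.trans b23))
    have a4 := planeNorm_sub_eq_of_apply_eq hB hk hg₃ hz₄' c3'
    rw [sub_zero, sub_zero] at a3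
    rw [nab'] at a4
    have c4 : k (-t, 0) = g₄ (t, 0) := by
      rcases hexagon ht isPlaneSymm_rot a3 (by simpa using a4) with h | h
      · refine absurd ?_ (n23 t ht)
        rw [← hz₄', h, ← hk1b t ht.le ht2]
        simp
      · rw [← hz₄, h]
        simp
    refine ⟨c4, ?_⟩
    obtain ⟨z₅, hz₅⟩ := k2 _ (mb t ht.le) ((nb t ht.le ht2).trans l4)
    have a5 := planeNorm_sub_eq_of_apply_eq hB hk hg₄ hz₅ (bk.trans (b12.trans (b23.trans b34)))
    have a6 := planeNorm_sub_eq_of_apply_eq hB hk hg₄ hz₅ c4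
    rw [sub_zero, sub_zero] at a5
    rw [nab'] at a6
    rcases hexagon ht (isPlaneSymm_rot.trans isPlaneSymm_rot) a5 (by simpa using a6) with h | h
    · refine absurd ?_ (n34 t ht)
      rw [← hz₅, h, ← c3']
      simp
    · rw [← hz₅, h]
      simp
  refine ⟨k, hk, ⟨ε₃, hε₃, by simpa using k1⟩, η, hη, fun z hz hn => ?_⟩
  obtain ⟨h3, h4⟩ := mem_closedCell_neg_one_neg_one.1 hz
  rw [zero_add]
  -- Agreement on the two edges gives agreement inside: `z` lies on the segment from `(-τ, 0)` to
  -- `(0, -τ)`.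
  set τ := - z.1 - z.2 with hτ
  have hτ0 : 0 ≤ τ := by linarith
  rcases hτ0.eq_or_lt with h0 | hτ0
  · have : z = 0 := Prod.ext (by simp; linarith) (by simp; linarith)
    simp [this, bk, b12, b23, b34]
  · have hτη : τ < η := by
      refine lt_of_le_of_lt ?_ hn
      refine (sq_le_sq₀ hτ0.le (planeNorm_nonneg _)).1 ?_
      rw [planeNorm_sq]
      nlinarith [sq_nonneg (z.1 + z.2), mul_nonneg_of_nonpos_of_nonpos h3 h4]
    obtain ⟨c1, c2⟩ := e2 τ hτ0 hτη
    have hg₄' := mem_planeCharts_comp hg₄ isPlaneSymm_neg 0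
    have := apply_segment_eq hB hk hg₄' (u := (-τ, 0)) (v := (0, -τ)) (u' := (-τ, 0))
      (v' := (0, -τ)) (by simpa using c1) (by simpa using c2) (r := - z.2 / τ)
      (div_nonneg (by linarith) hτ0.le) ((div_le_one hτ0).2 (by linarith))
    have hz' : ((-τ, 0) : ℝ × ℝ) + (-z.2 / τ) • ((0, -τ) - (-τ, 0)) = z := by
      ext
      · simp [hτ0.ne']; linarith
      · simp [hτ0.ne']
    rw [hz'] at this
    simpa using this

/-! ### Sectors opposite at their base point -/

/-- Retract onto `k` from the germ of the sector of `g₄`: then `g₄ (a, b)` goes to `-(a, b)`. An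
apartment containing this germ and `g₁ (a, b)` contains the segment from the common origin to `g₁
(a, b)`, hence the chamber germ of `g₁`, so `g₁ (a, b)` goes to `(a, b)`. The retraction does not
increase distances. -/
theorem planeNorm_le_bdist_of_opposite (hB : IsAffineBuilding weylA2 B) {k g₁ g₄ : ℝ × ℝ → X}
    (hk : k ∈ planeCharts B) (hg₁ : g₁ ∈ planeCharts B) (hg₄ : g₄ ∈ planeCharts B)
    (h1 : AgreeAt k g₁ 0 (1, 1)) (h4 : AgreeAt k (fun z => g₄ (-z)) 0 (-1, -1)) {a b : ℝ}
    (ha : 0 < a) (hb : 0 < b) :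
    planeNorm ((2 : ℝ) • (a, b)) ≤ bdist B (g₁ (a, b)) (g₄ (a, b)) := by
  have hg₄' : (fun z => g₄ (-z)) ∈ planeCharts B := by
    simpa using mem_planeCharts_comp hg₄ isPlaneSymm_neg 0
  obtain ⟨l, hl, l1, l2⟩ := exists_agreeAt_mem_germ hB hk hg₁ 0 (-1, -1) (a, b) 0
  have l3 : Set.range l ∈ germ g₁ 0 (a, b) := by
    refine range_mem_germ_of_mem hB hg₁ hl ?_ ?_
    · rw [← h1.apply_eq, ← l1.apply_eq]; exact ⟨_, rfl⟩
    · rw [zero_add]; exact mem_germ_zero.1 l2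
  rw [germ_congr_cell g₁ 0 (cell_of_pos ha hb), ← h1.germ_eq] at l3
  obtain ⟨m, hm, hr, m1, m2⟩ := exists_chart_agreeAt hB hk hl l3 l1.range_mem
  obtain ⟨c, hc⟩ := mem_germ_zero.1 l2
  obtain ⟨d, hd⟩ : l c ∈ Set.range m := by rw [hr]; exact ⟨c, rfl⟩
  obtain rfl := (m1.trans h1).eq_of_apply_eq hB hm hg₁ generic_one_one (hd.trans hc)
  obtain ⟨q, hq, q1, q2⟩ := exists_common_chart hB hg₁ hg₄ (a, b) 0 (a, b) 0
  obtain ⟨x, hx⟩ := mem_germ_zero.1 q1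
  obtain ⟨y, hy⟩ := mem_germ_zero.1 q2
  have := planeNorm_sub_le_of_agreeAt hB hk hm hg₄' hq generic_neg_one_neg_one m2 h4.symm
    (u := x) (v := y) (u' := (a, b)) (v' := -(a, b)) (hd.trans (hc.trans hx.symm))
    (by simpa using hy.symm)
  rw [sub_neg_eq_add, ← two_smul ℝ] at this
  rwa [← hx, ← hy, bdist_apply hB hq]

/-- In an apartment, the middle of two symmetric points of opposite sectors is the common
origin of these sectors. -/
theorem middle_eq_of_opposite (hB : IsAffineBuilding weylA2 B) {k g₁ g₄ h : ℝ × ℝ → X}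
    (hk : k ∈ planeCharts B) (hg₁ : g₁ ∈ planeCharts B) (hg₄ : g₄ ∈ planeCharts B)
    (h1 : AgreeAt k g₁ 0 (1, 1)) (h4 : AgreeAt k (fun z => g₄ (-z)) 0 (-1, -1)) {a b : ℝ}
    (ha : 0 < a) (hb : 0 < b) (hh : h ∈ planeCharts B) {u v : ℝ × ℝ} (hu : h u = g₁ (a, b))
    (hv : h v = g₄ (a, b)) : g₁ 0 = h (u + (1 / 2 : ℝ) • (v - u)) := by
  have hd := planeNorm_le_bdist_of_opposite hB hk hg₁ hg₄ h1 h4 ha hb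
  rw [← hu, ← hv, bdist_apply hB hh, planeNorm_smul zero_le_two, planeNorm_sub_comm] at hd
  have h0 : g₁ 0 = g₄ 0 := by rw [← h1.apply_eq, h4.apply_eq, neg_zero]
  refine eq_of_between hB hh hg₁ (by norm_num) (by norm_num) ?_ ?_
  · rw [hu, bdist_apply hB hg₁, sub_zero]; linarith
  · rw [hv, h0, bdist_apply hB hg₄, planeNorm_sub_comm, sub_zero]; linarith

/-- Large parts of two opposite sectors lie in a common apartment. -/
theorem exists_chart_of_opposite (hB : IsAffineBuilding weylA2 B) {k g₁ g₄ : ℝ × ℝ → X}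
    (hk : k ∈ planeCharts B) (hg₁ : g₁ ∈ planeCharts B) (hg₄ : g₄ ∈ planeCharts B)
    (h1 : AgreeAt k g₁ 0 (1, 1)) (h4 : AgreeAt k (fun z => g₄ (-z)) 0 (-1, -1)) {n : ℝ}
    (hn : 0 < n) : ∃ h ∈ planeCharts B, AgreeAt h k 0 (1, 1) ∧
      ∀ s t, 0 ≤ s → s ≤ n → 0 ≤ t → t ≤ n → h (s, t) = g₁ (s, t) ∧ h (-s, -t) = g₄ (s, t) := by
  have hg₄' : (fun z => g₄ (-z)) ∈ planeCharts B := by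
    simpa using mem_planeCharts_comp hg₄ isPlaneSymm_neg 0
  -- It suffices that `l` contain the two far corners: the common origin is their midpoint, and then
  -- both chamber germs and both parallelograms lie in `l`.
  obtain ⟨l, hl, l1, l2⟩ := exists_common_chart hB hg₁ hg₄ (n, n) 0 (n, n) 0
  rw [mem_germ_zero] at l1 l2
  have l0 : g₁ 0 ∈ Set.range l := by
    obtain ⟨u, hu⟩ := l1
    obtain ⟨v, hv⟩ := l2
    exact ⟨_, (middle_eq_of_opposite hB hk hg₁ hg₄ h1 h4 hn hn hl hu hv).symm⟩
  have h0 : g₁ 0 = g₄ 0 := by rw [← h1.apply_eq, h4.apply_eq, neg_zero]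
  have m1 := range_mem_germ_of_mem hB hg₁ hl (u := 0) (w := (n, n)) l0 (by rwa [zero_add])
  rw [germ_congr_cell g₁ 0 (cell_of_pos hn hn), ← h1.germ_eq] at m1
  have m2 := range_mem_germ_of_mem hB hg₄' hl (u := 0) (w := (-n, -n))
    (by rwa [neg_zero, ← h0]) (by simpa using l2)
  rw [germ_congr_cell _ 0 (cell_of_neg (neg_neg_of_pos hn) (neg_neg_of_pos hn)),
    ← h4.germ_eq] at m2
  obtain ⟨h, hh, hr, r1, r2⟩ := exists_chart_agreeAt hB hk hl m1 m2
  refine ⟨h, hh, r1, fun s t hs hsn ht htn => ⟨?_, ?_⟩⟩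
  · have := parallelogram_subset_range hB hg₁ hl (u := 0) hn hn l0 (by rwa [zero_add]) hs hsn
      ht htn
    rw [zero_add, ← hr] at this
    obtain ⟨z, hz⟩ := this
    rw [← hz, (r1.trans h1).eq_of_apply_eq hB hh hg₁ generic_one_one hz]
  · have := parallelogram_subset_range hB hg₄ hl (u := 0) hn hn (h0 ▸ l0) (by rwa [zero_add])
      hs hsn ht htn
    rw [zero_add, ← hr] at this
    obtain ⟨z, hz⟩ := this
    have e := (r2.trans h4).eq_of_apply_eq hB hh hg₄' generic_neg_one_neg_one (a := z)
      (b := -(s, t)) (by simpa using hz)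
    rw [← hz, e]
    rfl

/-- Two opposite sectors lie in the image of a map which coincides with a chart on every
bounded set. -/
theorem exists_union_chart (hB : IsAffineBuilding weylA2 B) {k g₁ g₄ : ℝ × ℝ → X}
    (hk : k ∈ planeCharts B) (hg₁ : g₁ ∈ planeCharts B) (hg₄ : g₄ ∈ planeCharts B)
    (h1 : AgreeAt k g₁ 0 (1, 1)) (h4 : AgreeAt k (fun z => g₄ (-z)) 0 (-1, -1)) :
    ∃ f : ℝ × ℝ → X, (∀ R : ℝ, ∃ h ∈ planeCharts B, ∀ z, ‖z‖ ≤ R → f z = h z) ∧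
      ∀ s t, 0 ≤ s → 0 ≤ t → g₁ (s, t) ∈ Set.range f ∧ g₄ (s, t) ∈ Set.range f := by
  have : Nonempty (ℝ × ℝ → X) := ⟨k⟩
  choose! H hH using fun n (hn : 0 < n) => exists_chart_of_opposite hB hk hg₁ hg₄ h1 h4 (n := n) hn
  have hpos : ∀ z : ℝ × ℝ, 0 < ‖z‖ + 1 := fun z => by positivity
  have hcons : ∀ n m, 0 < n → n ≤ m → ∀ z, ‖z‖ ≤ n → H n z = H m z := by
    intro n m hn hnm z hz
    have hm := hn.trans_le hnm
    obtain ⟨a1, a2, a3⟩ := hH n hn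
    obtain ⟨b1, b2, b3⟩ := hH m hm
    have hz1 := abs_le.1 ((norm_fst_le z).trans hz)
    have hz2 := abs_le.1 ((norm_snd_le z).trans hz)
    -- The norm on `ℝ × ℝ` is the sup norm, so its ball of radius `n` is the parallelogram spanned
    -- by `(-n, -n)` and `(n, n)`, whose images also lie in the larger apartment. Coordinates
    -- coincide because both charts agree with `k` on a chamber germ.
    have := parallelogram_subset_range hB a1 b1 (u := (-n, -n)) (a := 2 * n) (b := 2 * n)
      (s := z.1 + n) (t := z.2 + n) (by linarith) (by linarith)
      ⟨_, (b3 n n hn.le hnm hn.le hnm).2.trans (a3 n n hn.le le_rfl hn.le le_rfl).2.symm⟩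
      ⟨(n, n), by
        rw [(b3 n n hn.le hnm hn.le hnm).1, ← (a3 n n hn.le le_rfl hn.le le_rfl).1]
        congr 1
        ext <;> simp <;> ring⟩
      (by linarith) (by linarith) (by linarith) (by linarith)
    rw [show ((-n, -n) : ℝ × ℝ) + (z.1 + n, z.2 + n) = z by ext <;> simp] at this
    obtain ⟨y, hy⟩ := this
    rw [← hy, (b2.trans a2.symm).eq_of_apply_eq hB b1 a1 generic_one_one hy]
  -- The added `1` keeps the size positive even at `z = 0`.
  refine ⟨fun z => H (‖z‖ + 1) z, fun R => ?_, fun s t hs ht => ?_⟩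
  · have hR : 0 < |R| + 1 := by positivity
    exact ⟨H (|R| + 1), (hH _ hR).1, fun z hz => hcons _ _ (hpos z)
      (by linarith [le_abs_self R]) z (by linarith)⟩
  · have hs' : s ≤ ‖((s, t) : ℝ × ℝ)‖ + 1 := by
      have := (le_abs_self s).trans (norm_fst_le ((s, t) : ℝ × ℝ))
      linarith
    have ht' : t ≤ ‖((s, t) : ℝ × ℝ)‖ + 1 := by
      have := (le_abs_self t).trans (norm_snd_le ((s, t) : ℝ × ℝ))
      linarith
    have := (hH _ (hpos (s, t))).2.2 s t hs hs' ht ht'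
    refine ⟨⟨(s, t), this.1⟩, ⟨-(s, t), ?_⟩⟩
    change H (‖-((s, t) : ℝ × ℝ)‖ + 1) (-s, -t) = _
    rw [norm_neg, this.2]

/-! ### Completeness of the system of apartments -/

theorem norm_le_planeNorm (z : ℝ × ℝ) : ‖z‖ ≤ planeNorm z := by
  have h := planeNorm_sq z
  refine max_le ?_ ?_ <;> refine abs_le_of_sq_le_sq ?_ (planeNorm_nonneg z) <;>
    nlinarith [sq_nonneg (z.1 + 2 * z.2), sq_nonneg (2 * z.1 + z.2), sq_nonneg z.1, sq_nonneg z.2]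

/-- A map which coincides with a chart on every bounded set. -/
def IsLocalChart (B : BuildingData X) (f : ℝ × ℝ → X) : Prop :=
  ∀ R : ℝ, ∃ h ∈ planeCharts B, ∀ z, ‖z‖ ≤ R → f z = h z

theorem isLocalChart_of_mem {g : ℝ × ℝ → X} (hg : g ∈ planeCharts B) : IsLocalChart B g :=
  fun _ => ⟨g, hg, fun _ _ => rfl⟩

theorem agreeAt_of_norm_le {f h : ℝ × ℝ → X} {R : ℝ} (hf : ∀ z, ‖z‖ ≤ R → f z = h z)
    {u : ℝ × ℝ} (hu : ‖u‖ + 1 ≤ R) (w : ℝ × ℝ) : AgreeAt f h u w :=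
  ⟨1, one_pos, fun z _ hn => hf _ (by
    have := norm_add_le u z
    linarith [norm_le_planeNorm z])⟩

theorem IsLocalChart.injective {f : ℝ × ℝ → X} (hf : IsLocalChart B f) :
    Function.Injective f := by
  intro a b hab
  obtain ⟨h, hh, hfh⟩ := hf (max ‖a‖ ‖b‖)
  rw [hfh a (le_max_left _ _), hfh b (le_max_right _ _)] at hab
  exact hh.2.injective hab

theorem IsLocalChart.bdist_apply (hB : IsAffineBuilding weylA2 B) {f : ℝ × ℝ → X}
    (hf : IsLocalChart B f) (a b : ℝ × ℝ) : bdist B (f a) (f b) = planeNorm (a - b) := by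
  obtain ⟨h, hh, hfh⟩ := hf (max ‖a‖ ‖b‖)
  rw [hfh a (le_max_left _ _), hfh b (le_max_right _ _), AffBuilding.bdist_apply hB hh]

theorem IsLocalChart.germ_mem_facets {f : ℝ × ℝ → X} (hf : IsLocalChart B f) (u w : ℝ × ℝ) :
    germ f u w ∈ B.facets := by
  obtain ⟨h, hh, hfh⟩ := hf (‖u‖ + 1)
  rw [(agreeAt_of_norm_le hfh le_rfl w).germ_eq]
  exact AffBuilding.germ_mem_facets hh u w

theorem exists_eq_germ_of_mem_facets (hB : IsAffineBuilding weylA2 B) {σ : Filter X}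
    (hσ : σ ∈ B.facets) : ∃ g ∈ planeCharts B, ∃ u w, σ = germ g u w := by
  obtain ⟨A, hA, h1, -⟩ := hB.exists_apartment σ hσ σ hσ
  obtain ⟨f, hf⟩ := hB.exists_chart A hA
  exact ⟨_, hf.isPlaneChart.mem hA, exists_eq_germ hf.isPlaneChart hσ h1⟩

/-- A facet has a representative of bounded diameter, so its points in the image of `f` have bounded
parameters. A true chart coinciding with `f` on a large ball therefore contains the facet, and it
remains to bound the base point read in that chart. -/
theorem IsLocalChart.exists_eq_germ (hB : IsAffineBuilding weylA2 B) {f : ℝ × ℝ → X}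
    (hf : IsLocalChart B f) {σ : Filter X} (hσ : σ ∈ B.facets) (h : Set.range f ∈ σ) :
    ∃ u w, σ = germ f u w := by
  obtain ⟨g, hg, u, w, rfl⟩ := exists_eq_germ_of_mem_facets hB hσ
  obtain ⟨ε, hε, hε'⟩ := mem_germ.1 h
  obtain ⟨z₀, hz₀, hn₀⟩ := exists_mem_cell_planeNorm_lt w hε
  obtain ⟨y₀, hy₀⟩ := hε' z₀ hz₀ hn₀
  have hbound : ∀ z y, planeNorm z < ε → f y = g (u + z) → ‖y‖ ≤ ‖y₀‖ + 2 * ε := by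
    intro z y hn hy
    have h1 : planeNorm (y - y₀) = planeNorm (z - z₀) := by
      rw [← hf.bdist_apply hB, hy, hy₀, AffBuilding.bdist_apply hB hg, add_sub_add_left_eq_sub]
    have h2 := planeNorm_add_le z (-z₀)
    rw [planeNorm_neg, ← sub_eq_add_neg] at h2
    have h3 := norm_le_planeNorm (y - y₀)
    have h4 := norm_le_norm_add_norm_sub' y y₀
    linarith
  -- One unit bounds the distance from the base point `u'` to a nearby point of the germ, the other
  -- is the margin required by `agreeAt_of_norm_le`.
  obtain ⟨k, hk, hfk⟩ := hf (‖y₀‖ + 2 * ε + 2)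
  have hkσ : Set.range k ∈ germ g u w := mem_germ.2 ⟨ε, hε, fun z hz hn => by
    obtain ⟨y, hy⟩ := hε' z hz hn
    rw [← hy, hfk y (by linarith [hbound z y hn hy])]
    exact ⟨y, rfl⟩⟩
  obtain ⟨u', w', he⟩ := AffBuilding.exists_eq_germ hk.2 hσ hkσ
  have hZ : {p | ∃ z, z ∈ cell w ∧ planeNorm z < ε ∧ g (u + z) = p} ∈ germ k u' w' := by
    rw [← he]
    exact mem_germ.2 ⟨ε, hε, fun z hz hn => ⟨z, hz, hn, rfl⟩⟩
  obtain ⟨δ, hδ, hδ'⟩ := mem_germ.1 hZ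
  obtain ⟨z', hz', hn'⟩ := exists_mem_cell_planeNorm_lt w' (lt_min hδ one_pos)
  obtain ⟨z, hz, hn, hzz⟩ := hδ' z' hz' (hn'.trans_le (min_le_left _ _))
  obtain ⟨y, hy⟩ := hε' z hz hn
  have hyb := hbound z y hn hy
  have hyy : y = u' + z' := hk.2.injective (by rw [← hfk y (by linarith), hy, hzz])
  have hu' : ‖u'‖ ≤ ‖y‖ + ‖z'‖ := by
    have := norm_sub_le y z'
    rwa [hyy, add_sub_cancel_right, ← hyy] at this
  have hz1 := (norm_le_planeNorm z').trans_lt (hn'.trans_le (min_le_right _ _))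
  exact ⟨u', w', he.trans (agreeAt_of_norm_le hfk (by linarith) w').germ_eq.symm⟩

open Classical in
/-- The building data obtained by adding an apartment. -/
noncomputable def BuildingData.adjoin (B : BuildingData X) (A : Set X) : BuildingData X where
  facets := B.facets
  apartments := insert A B.apartments
  dA A' p q := if A' ∈ B.apartments then B.dA A' p q else bdist B p q

theorem isPlaneChart_adjoin_of_mem {g : ℝ × ℝ → X} (hg : g ∈ planeCharts B) (A : Set X) :
    IsPlaneChart (B.adjoin A) (Set.range g) g := by
  refine ⟨hg.2.injective, rfl, fun u v => ?_, hg.2.facets_eq⟩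
  rw [← hg.2.dist_eq]
  exact if_pos hg.1

theorem IsLocalChart.isPlaneChart_adjoin (hB : IsAffineBuilding weylA2 B) {f : ℝ × ℝ → X}
    (hf : IsLocalChart B f) (hA : Set.range f ∉ B.apartments) :
    IsPlaneChart (B.adjoin (Set.range f)) (Set.range f) f := by
  refine ⟨hf.injective, rfl, fun u v => ?_, ?_⟩
  · rw [← hf.bdist_apply hB]
    exact if_neg hA
  · ext σ
    constructor
    · rintro ⟨⟨u, w⟩, rfl⟩
      exact ⟨hf.germ_mem_facets u w, range_mem_germ f u w⟩
    · rintro ⟨hσ, h⟩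
      obtain ⟨u, w, rfl⟩ := hf.exists_eq_germ hB hσ h
      exact ⟨(u, w), rfl⟩

/-- Points of the cell of length less than `ε / 2` represent the facet; their closure stays in the
closed cell and at length less than `ε`, where `f'` and `f` agree. -/
theorem AgreeAt.fixesClosure {C : BuildingData X} {A : Set X} {f f' : ℝ × ℝ → X} {φ : X → X}
    (hf : IsPlaneChart C A f) (hφ : ∀ z, φ (f z) = f' z) {u w : ℝ × ℝ} (h : AgreeAt f' f u w) :
    C.FixesClosure A φ (germ f u w) := by
  obtain ⟨ε, hε, h⟩ := h
  refine ⟨{p | ∃ z, z ∈ cell w ∧ planeNorm z < ε / 2 ∧ f (u + z) = p},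
    mem_germ.2 ⟨ε / 2, by positivity, fun z hz hn => ⟨z, hz, hn, rfl⟩⟩, ?_⟩
  rintro p ⟨hp, hcl⟩
  rw [← hf.range_eq] at hp
  obtain ⟨y, rfl⟩ := hp
  have hcl' : ∀ η > 0, ∃ z ∈ cell w, planeNorm z < ε / 2 ∧ planeNorm (z - (y - u)) < η := by
    intro η hη
    obtain ⟨_, ⟨⟨z, hz, hn, rfl⟩, -⟩, hd⟩ := hcl η hη
    refine ⟨z, hz, hn, ?_⟩
    rwa [hf.dist_eq, planeNorm_sub_comm,
      show u + z - y = z - (y - u) by abel] at hd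
  have h1 : y - u ∈ closedCell w := by
    rw [← closure_cell, mem_closure_iff_nhds_basis (nhds_hasBasis_planeNorm _)]
    intro η hη
    obtain ⟨z, hz, -, hd⟩ := hcl' η hη
    exact ⟨z, hz, hd⟩
  have h2 : planeNorm (y - u) < ε := by
    obtain ⟨z, hz, hn, hd⟩ := hcl' (ε / 2) (by positivity)
    have := planeNorm_add_le z (-(z - (y - u)))
    rw [planeNorm_neg, neg_sub, add_sub_cancel] at this
    linarith
  have := h _ h1 h2
  rw [hφ]
  simpa using this

/-- Axiom (B2) extended to local charts. On a ball large enough for both facets, `f₁` and `f₂` are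
true charts `h₁` and `h₂`. The isomorphism given by (B2) is read as a transformation `T` of the
whole plane, and `f₂ ∘ T ∘ f₁⁻¹` is the desired global map; it fixes the facets since only bounded
regions matter there. -/
theorem exists_isApartmentIso (hB : IsAffineBuilding weylA2 B) {C : BuildingData X}
    {A₁ A₂ : Set X} {f₁ f₂ : ℝ × ℝ → X} (hl₁ : IsLocalChart B f₁) (hl₂ : IsLocalChart B f₂)
    (hf₁ : IsPlaneChart C A₁ f₁) (hf₂ : IsPlaneChart C A₂ f₂) {σ τ : Filter X}
    (hσ : σ ∈ C.facetsIn (A₁ ∩ A₂)) (hτ : τ ∈ C.facetsIn (A₁ ∩ A₂)) :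
    ∃ φ : X → X, C.IsApartmentIso A₁ A₂ φ ∧ C.FixesClosure A₁ φ σ ∧ C.FixesClosure A₁ φ τ := by
  have key : ∀ ρ ∈ C.facetsIn (A₁ ∩ A₂), ∃ u w u' w', ρ = germ f₁ u w ∧
      germ f₁ u w = germ f₂ u' w' := by
    rintro ρ ⟨h1, h2⟩
    obtain ⟨u, w, rfl⟩ := exists_eq_germ hf₁ h1 (Filter.mem_of_superset h2 Set.inter_subset_left)
    obtain ⟨u', w', h⟩ := exists_eq_germ hf₂ h1 (Filter.mem_of_superset h2 Set.inter_subset_right)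
    exact ⟨u, w, u', w', rfl, h⟩
  obtain ⟨u, w, u₂, w₂, rfl, hu⟩ := key σ hσ
  obtain ⟨v, y, v₂, y₂, rfl, hv⟩ := key τ hτ
  obtain ⟨R, hR⟩ : ∃ R, R = ‖u‖ + ‖u₂‖ + ‖v‖ + ‖v₂‖ + 4 := ⟨_, rfl⟩
  have n1 := norm_nonneg u
  have n2 := norm_nonneg u₂
  have n3 := norm_nonneg v
  have n4 := norm_nonneg v₂
  obtain ⟨h₁, hh₁, e₁⟩ := hl₁ R
  obtain ⟨h₂, hh₂, e₂⟩ := hl₂ R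
  have gu : germ h₁ u w = germ h₂ u₂ w₂ := by
    rw [← (agreeAt_of_norm_le e₁ (by linarith) w).germ_eq, hu,
      (agreeAt_of_norm_le e₂ (by linarith) w₂).germ_eq]
  have gv : germ h₁ v y = germ h₂ v₂ y₂ := by
    rw [← (agreeAt_of_norm_le e₁ (by linarith) y).germ_eq, hv,
      (agreeAt_of_norm_le e₂ (by linarith) y₂).germ_eq]
  obtain ⟨k, hk, hr, k1, k2⟩ := exists_chart_agreeAt hB hh₁ hh₂
    (gu ▸ range_mem_germ h₂ u₂ w₂) (gv ▸ range_mem_germ h₂ v₂ y₂)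
  obtain ⟨T, hT, hkT⟩ := exists_transition hh₂.2 (hr ▸ hk.2)
  have hf₃ := hf₂.comp hT
  have hinv : ∀ z, f₂ (T (Function.invFun f₁ (f₁ z))) = f₂ (T z) := fun z => by
    rw [Function.leftInverse_invFun hf₁.injective z]
  have agree : ∀ a b a₂ b₂ : ℝ × ℝ, ‖a‖ + 4 ≤ R → ‖a₂‖ + 4 ≤ R → germ h₁ a b = germ h₂ a₂ b₂ →
      AgreeAt k h₁ a b → AgreeAt (f₂ ∘ T) f₁ a b := by
    intro a b a₂ b₂ ha ha₂ hg hk1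
    have hZ : {p | ∃ z, planeNorm z < 1 ∧ h₂ (a₂ + z) = p} ∈ germ k a b := by
      rw [hk1.germ_eq, hg]
      exact mem_germ.2 ⟨1, one_pos, fun z _ hn => ⟨z, hn, rfl⟩⟩
    obtain ⟨δ, hδ, hδ'⟩ := mem_germ.1 hZ
    obtain ⟨z, hz, hn⟩ := exists_mem_cell_planeNorm_lt b (lt_min hδ one_pos)
    obtain ⟨z', hn', hzz⟩ := hδ' z hz (hn.trans_le (min_le_left _ _))
    rw [hkT] at hzz
    have hTz : a₂ + z' = T (a + z) := hh₂.2.injective hzz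
    -- `T` is isometric and sends a point within `1` of `a` to a point within `1` of `a₂`. Points
    -- within `1` of `a` thus have images of norm at most `‖a₂‖ + 3`, inside the ball of radius `R`.
    have hTa : ‖T a‖ ≤ ‖a₂‖ + 2 := by
      have h1 := norm_le_planeNorm (T a - T (a + z))
      rw [hT.dist_eq, sub_add_cancel_left, planeNorm_neg] at h1
      have h2 := norm_le_norm_add_norm_sub' (T a) (T (a + z))
      rw [← hTz] at h1 h2
      have h3 := norm_add_le a₂ z'
      have h4 := norm_le_planeNorm z'
      have h5 := hn.trans_le (min_le_right _ _)
      linarith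
    obtain ⟨ε, hε, hk1⟩ := hk1
    refine ⟨min ε 1, lt_min hε one_pos, fun x hx hxn => ?_⟩
    have hx1 := hxn.trans_le (min_le_right _ _)
    have hxk := hk1 x hx (hxn.trans_le (min_le_left _ _))
    rw [Function.comp_apply, e₂, e₁, ← hxk, hkT, Function.comp_apply]
    · have h1 := norm_add_le a x
      linarith [norm_le_planeNorm x]
    · have h1 := norm_le_planeNorm (T (a + x) - T a)
      rw [hT.dist_eq, add_sub_cancel_left] at h1
      have h2 := norm_le_norm_add_norm_sub' (T (a + x)) (T a)
      linarith
  refine ⟨fun p => f₂ (T (Function.invFun f₁ p)), ⟨⟨?_, ?_, ?_⟩, ?_, ?_⟩,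
    (agree u w u₂ w₂ (by linarith) (by linarith) gu k1).fixesClosure hf₁ hinv,
    (agree v y v₂ y₂ (by linarith) (by linarith) gv k2).fixesClosure hf₁ hinv⟩
  · intro p _
    rw [← hf₃.range_eq]
    exact ⟨_, rfl⟩
  · rw [← hf₁.range_eq]
    rintro _ ⟨a, rfl⟩ _ ⟨b, rfl⟩ hab
    simp only [hinv] at hab
    rw [hf₃.injective hab]
  · rw [← hf₁.range_eq, ← hf₃.range_eq]
    rintro _ ⟨a, rfl⟩
    exact ⟨f₁ a, ⟨a, rfl⟩, hinv a⟩
  · rw [← hf₁.range_eq]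
    rintro _ ⟨a, rfl⟩ _ ⟨b, rfl⟩
    simp only [hinv]
    rw [hf₁.range_eq, hf₁.dist_eq]
    exact hf₃.dist_eq a b
  · rw [← hf₁.facets_eq, ← hf₃.facets_eq, ← Set.range_comp]
    congr 1
    funext p
    rw [Function.comp_apply, Filter.map_map]
    congr 1
    funext z
    exact hinv z

/-- In a complete system of apartments, the image of a map which coincides with a chart on every
bounded set is an apartment. -/
theorem IsLocalChart.range_mem_apartments (hB : IsAffineBuilding weylA2 B)
    (hcomplete : HasCompleteApartments weylA2 B) {f : ℝ × ℝ → X} (hf : IsLocalChart B f) :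
    Set.range f ∈ B.apartments := by
  by_contra hA
  have hcharts : ∀ A ∈ (B.adjoin (Set.range f)).apartments, ∃ g, IsLocalChart B g ∧
      IsPlaneChart (B.adjoin (Set.range f)) A g := by
    rintro A (rfl | hA')
    · exact ⟨f, hf, hf.isPlaneChart_adjoin hB hA⟩
    · obtain ⟨g, hg⟩ := hB.exists_chart A hA'
      have hg' := hg.isPlaneChart.mem hA'
      have := isPlaneChart_adjoin_of_mem hg' (Set.range f)
      rw [hg.isPlaneChart.range_eq] at this
      exact ⟨_, isLocalChart_of_mem hg', this⟩
  have hB' : IsAffineBuilding weylA2 (B.adjoin (Set.range f)) := by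
    refine ⟨fun A hA' => ?_, fun σ hσ τ hτ => ?_, fun A₁ h₁ A₂ h₂ p hp => ?_,
      fun A₁ h₁ A₂ h₂ σ hσ τ hτ => ?_⟩
    · obtain ⟨g, -, hg⟩ := hcharts A hA'
      exact ⟨_, isPlaneChart_iff.1 hg⟩
    · obtain ⟨A, hA', h⟩ := hB.exists_apartment σ hσ τ hτ
      exact ⟨A, Or.inr hA', h⟩
    -- Points are themselves facets, so every intersection is a union of facets.
    · obtain ⟨g, hgl, hg⟩ := hcharts A₁ h₁
      have hp1 := hp.1
      rw [← hg.range_eq] at hp1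
      obtain ⟨u, rfl⟩ := hp1
      refine ⟨germ g u 0, ⟨hgl.germ_mem_facets u 0, mem_germ_zero.2 hp⟩, (germ_zero g u).ge⟩
    · obtain ⟨g₁, hl₁, hg₁⟩ := hcharts A₁ h₁
      obtain ⟨g₂, hl₂, hg₂⟩ := hcharts A₂ h₂
      exact exists_isApartmentIso hB hl₁ hl₂ hg₁ hg₂ hσ hτ
  have := hcomplete _ hB' rfl (Set.subset_insert _ _) fun A hA' p _ q _ => if_pos hA'
  exact hA (this ▸ Set.mem_insert _ _)

/-! ### Sectors and their faces in coordinates -/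

/-- Expresses closed cells through open ones, so that symmetries preserving the cells preserve their
closures. -/
theorem mem_closedCell_iff {z w : ℝ × ℝ} :
    z ∈ closedCell w ↔ ∀ δ : ℝ, 0 < δ → z + δ • w ∈ cell w := by
  refine ⟨fun h δ hδ => add_smul_mem_cell h hδ, fun h => ?_⟩
  have ht : Filter.Tendsto (fun δ : ℝ => z + δ • w) (𝓝[>] 0) (𝓝 z) := by
    have : Continuous fun δ : ℝ => z + δ • w := by fun_prop
    simpa using (this.tendsto 0).mono_left nhdsWithin_le_nhds
  rw [← closure_cell]
  exact mem_closure_of_tendsto ht (Filter.eventually_of_mem self_mem_nhdsWithin h)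

theorem IsPlaneSymm.mem_closedCell {σ : (ℝ × ℝ) ≃ₗ[ℝ] (ℝ × ℝ)} (hσ : IsPlaneSymm σ)
    (z w : ℝ × ℝ) : σ z ∈ closedCell (σ w) ↔ z ∈ closedCell w := by
  rw [mem_closedCell_iff, mem_closedCell_iff]
  refine forall₂_congr fun δ _ => ?_
  rw [← map_smul, ← map_add, hσ.mem_cell]

theorem IsPlaneSymm.image_closedCell {σ : (ℝ × ℝ) ≃ₗ[ℝ] (ℝ × ℝ)} (hσ : IsPlaneSymm σ)
    (w : ℝ × ℝ) : σ '' closedCell w = closedCell (σ w) := by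
  ext z
  constructor
  · rintro ⟨y, hy, rfl⟩; exact (hσ.mem_closedCell y w).2 hy
  · intro hz
    refine ⟨σ.symm z, ?_, by simp⟩
    rwa [← hσ.mem_closedCell, LinearEquiv.apply_symm_apply]

theorem closedCell_congr {w w' : ℝ × ℝ} (h : cell w = cell w') : closedCell w = closedCell w' := by
  rw [← closure_cell, h, closure_cell]

/-- The symmetries of the plane act transitively on the chambers. -/
theorem exists_symm_cell_eq {w : ℝ × ℝ} (hw : Generic w) :
    ∃ σ : (ℝ × ℝ) ≃ₗ[ℝ] (ℝ × ℝ), IsPlaneSymm σ ∧ cell (σ (1, 1)) = cell w := by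
  have key : ∀ (τ : (ℝ × ℝ) ≃ₗ[ℝ] (ℝ × ℝ)), IsPlaneSymm τ →
      0 < (τ (1, 1)).1 * w.1 → 0 < (τ (1, 1)).2 * w.2 →
      0 < ((τ (1, 1)).1 + (τ (1, 1)).2) * (w.1 + w.2) →
      ∃ σ : (ℝ × ℝ) ≃ₗ[ℝ] (ℝ × ℝ), IsPlaneSymm σ ∧ cell (σ (1, 1)) = cell w := by
    intro τ hτ h1 h2 h3
    refine ⟨τ, hτ, cell_eq_of_mem (mem_cell_iff.2 ⟨?_, ?_, ?_⟩)⟩ <;> rw [sign_eq_iff]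
    · exact ⟨fun h => absurd h (hw 0), fun _ => h1⟩
    · exact ⟨fun h => absurd h (hw 1), fun _ => h2⟩
    · exact ⟨fun h => absurd h (hw 2), fun _ => h3⟩
  have r1 := isPlaneSymm_rot
  have r2 := r1.trans r1
  have n := isPlaneSymm_neg
  rcases lt_or_gt_of_ne (hw 0) with h0 | h0 <;> rcases lt_or_gt_of_ne (hw 1) with h1 | h1 <;>
    rcases lt_or_gt_of_ne (hw 2) with h2 | h2 <;> simp only [ell_zero, ell_one, ell_two] at h0 h1 h2
  · exact key _ n (by simp; linarith) (by simp; linarith) (by simp; linarith)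
  · linarith
  · exact key _ r2 (by norm_num; linarith) (by norm_num; linarith) (by norm_num; linarith)
  · exact key _ r1 (by norm_num; linarith) (by norm_num; linarith) (by norm_num; linarith)
  · exact key _ (r1.trans n) (by norm_num; linarith) (by norm_num; linarith)
      (by norm_num; linarith)
  · exact key _ (r2.trans n) (by norm_num; linarith) (by norm_num; linarith)
      (by norm_num; linarith)
  · linarith
  · exact key _ isPlaneSymm_refl (by simp; linarith) (by simp; linarith) (by simp; linarith)

/-- The image of the first coordinate half axis. -/
def axis (g : ℝ × ℝ → X) : Set X := (fun t : ℝ => g (t, 0)) '' Set.Ici 0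

theorem closedCell_pos_zero {s : ℝ} (hs : 0 < s) :
    closedCell (s, 0) = (fun t : ℝ => (t, 0)) '' Set.Ici 0 := by
  ext z
  constructor
  · intro hz
    have h0 := (hz 0).2
    have h1 := (hz 1).1 rfl
    rw [ell_zero, ell_zero] at h0
    rw [ell_one] at h1
    exact ⟨z.1, nonneg_of_mul_nonneg_left h0 hs, Prod.ext rfl h1.symm⟩
  · rintro ⟨t, ht, rfl⟩ i
    have ht : 0 ≤ t := ht
    fin_cases i <;> simp [ell, hs.ne'] <;> positivity

/-- A face of a sector is the image of the first half axis in a suitable chart. -/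
theorem exists_chart_of_isFaceOfSectorAt {x : X} {S P : Set X}
    (h : IsFaceOfSectorAt weylA2 B x S P) :
    ∃ g ∈ planeCharts B, g 0 = x ∧ S = g '' closedCell (1, 1) ∧ P = axis g := by
  obtain ⟨A, hA, f, hf, v, C, F, hv, hC, hS, hF, hFC, hP⟩ := h
  obtain ⟨w, hw, rfl⟩ := weylChamber_eq hC
  obtain ⟨y, hy0, hy, rfl⟩ := vectorPanel_eq hF
  rw [closure_vectorFacet] at hS hFC hP
  have hyw : y ∈ closedCell w := by
    obtain ⟨z, hz, he⟩ := hFC ⟨y, mem_cell_self y, rfl⟩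
    rwa [← coordA2.injective he]
  suffices H : ∃ σ : (ℝ × ℝ) ≃ₗ[ℝ] (ℝ × ℝ), IsPlaneSymm σ ∧ cell (σ (1, 1)) = cell w ∧
      ∃ s, 0 < s ∧ σ (s, 0) = y by
    obtain ⟨σ, hσ, hσw, s, hs, rfl⟩ := H
    have key : ∀ Z : Set (ℝ × ℝ), f '' (v +ᵥ coordA2 '' (σ '' Z)) =
        (fun z => (f ∘ coordA2) (coordA2.symm v + σ z)) '' Z := by
      intro Z
      rw [← Set.image_vadd, Set.image_image, Set.image_image, Set.image_image]
      simp
    refine ⟨_, mem_planeCharts_comp (hf.isPlaneChart.mem hA) hσ (coordA2.symm v), by simpa using hv,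
      ?_, ?_⟩
    · rw [hS, ← closedCell_congr hσw, ← hσ.image_closedCell, key]
    · rw [hP, ← hσ.image_closedCell, key, closedCell_pos_zero hs, axis, Set.image_image]
  obtain ⟨σ, hσ, hσw⟩ := exists_symm_cell_eq hw
  rw [← closedCell_congr hσw, ← LinearEquiv.apply_symm_apply σ y, hσ.mem_closedCell,
    mem_closedCell_one_one] at hyw
  have hz0 : σ.symm y ≠ 0 := by simpa using hy0
  have hz : ¬ Generic (σ.symm y) := by
    intro hg
    apply hy
    have hmem : σ.symm y ∈ cell (1, 1) := by
      have := cell_of_pos (hyw.1.lt_of_ne' (hg 0)) (hyw.2.lt_of_ne' (hg 1))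
      rw [← this]
      exact mem_cell_self _
    rw [← hσ.mem_cell, LinearEquiv.apply_symm_apply, hσw] at hmem
    intro i hi
    have := hmem i
    rw [hi, sign_zero, eq_comm, sign_eq_zero_iff] at this
    exact hw i this
  obtain ⟨z, hzy⟩ : ∃ z, z = σ.symm y := ⟨_, rfl⟩
  have hσz : σ z = y := by rw [hzy]; simp
  rw [← hzy] at hyw hz0 hz
  -- A nonzero vector of the closed quadrant which is not generic lies on one of the half axes; the
  -- flip brings the second one to the first.
  rcases hyw.1.eq_or_lt with h1 | h1
  · have h2 : 0 < z.2 := hyw.2.lt_of_ne' fun h2 => hz0 (Prod.ext h1.symm h2)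
    refine ⟨coordFlip.trans σ, isPlaneSymm_flip.trans hσ, hσw, z.2, h2, ?_⟩
    rw [← hσz, LinearEquiv.trans_apply, flip_apply]
    congr 1
    exact Prod.ext h1 rfl
  · rcases hyw.2.eq_or_lt with h2 | h2
    · refine ⟨σ, hσ, hσw, z.1, h1, ?_⟩
      rw [← hσz]
      congr 1
      exact Prod.ext rfl h2
    · refine absurd (fun i => ?_) hz
      fin_cases i
      · exact h1.ne'
      · exact h2.ne'
      · exact (add_pos h1 h2).ne'

theorem planeNorm_axis (t : ℝ) : planeNorm (t, 0) = planeNorm (0, t) :=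
  planeNorm_eq_iff.2 (by ring)

/-- The opening of the chamber is `π / 3`, so an equilateral triangle with one vertex at its apex
has its other vertices on the edges. The distances give the inner product, the Gram determinant then
gives `(a d - b c)² = t⁴`, and comparing the two makes a sum of nonnegative products vanish. -/
theorem quadrant_corner {u v : ℝ × ℝ} {t : ℝ} (ht : 0 < t) (hu : u ∈ closedCell (1, 1))
    (hv : v ∈ closedCell (1, 1)) (h1 : planeNorm u = planeNorm (0, t))
    (h2 : planeNorm v = planeNorm (0, t)) (h3 : planeNorm (u - v) = planeNorm (0, t)) :
    u = (t, 0) ∨ u = (0, t) := by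
  rw [mem_closedCell_one_one] at hu hv
  rw [planeNorm_eq_iff] at h1 h2 h3
  simp only [Prod.fst_sub, Prod.snd_sub] at h1 h2 h3
  obtain ⟨a, b⟩ := u
  obtain ⟨c, d⟩ := v
  simp only at h1 h2 h3 hu hv
  obtain ⟨ha, hb⟩ := hu
  obtain ⟨hc, hd⟩ := hv
  have e1 : 2 * a * c + a * d + b * c + 2 * b * d = t ^ 2 := by linear_combination h1 + h2 - h3
  have e2 : (a * d - b * c) ^ 2 = (t ^ 2) ^ 2 := by
    have : 3 * (a * d - b * c) ^ 2 =
        4 * (a ^ 2 + a * b + b ^ 2) * (c ^ 2 + c * d + d ^ 2) - (t ^ 2) ^ 2 := by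
      rw [← e1]; ring
    rw [h1, h2] at this
    linarith
  have z1 : 0 ≤ a * c := mul_nonneg ha hc
  have z2 : 0 ≤ b * d := mul_nonneg hb hd
  have z3 : 0 ≤ a * d := mul_nonneg ha hd
  have z4 : 0 ≤ b * c := mul_nonneg hb hc
  have tt : 0 < t ^ 2 := by positivity
  rcases sq_eq_sq_iff_eq_or_eq_neg.1 e2 with h | h
  · left
    have hbc : b * c = 0 := by linarith
    have hbd : b * d = 0 := by linarith
    have hb0 : b = 0 := by
      by_contra hb0
      have hc0 := (mul_eq_zero.1 hbc).resolve_left hb0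
      have hd0 := (mul_eq_zero.1 hbd).resolve_left hb0
      rw [hc0, hd0] at h2
      linarith
    rw [hb0] at h1 ⊢
    have : a = t := by nlinarith
    rw [this]
  · right
    have had : a * d = 0 := by linarith
    have hac : a * c = 0 := by linarith
    have ha0 : a = 0 := by
      by_contra ha0
      have hc0 := (mul_eq_zero.1 hac).resolve_left ha0
      have hd0 := (mul_eq_zero.1 had).resolve_left ha0
      rw [hc0, hd0] at h2
      linarith
    rw [ha0] at h1 ⊢
    have : b = t := by nlinarith
    rw [this]

theorem apply_axis_eq_of_le (hB : IsAffineBuilding weylA2 B) {g h : ℝ × ℝ → X}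
    (hg : g ∈ planeCharts B) (hh : h ∈ planeCharts B) (h0 : g 0 = h 0) {v v' : ℝ × ℝ} {s t : ℝ}
    (hs : 0 ≤ s) (hst : s ≤ t) (ht : 0 < t) (h1 : g (t • v) = h (t • v')) :
    g (s • v) = h (s • v') := by
  have := apply_segment_eq hB hg hh h0 h1 (r := s / t) (by positivity) ((div_le_one ht).2 hst)
  simpa [smul_smul, ht.ne'] using this

theorem smul_one_zero (t : ℝ) : t • ((1, 0) : ℝ × ℝ) = (t, 0) := by simp

theorem smul_zero_one (t : ℝ) : t • ((0, 1) : ℝ × ℝ) = (0, t) := by simp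

/-- The first face of a sector is a face in any other chart of this sector. -/
theorem axis_eq_or_eq (hB : IsAffineBuilding weylA2 B) {g h : ℝ × ℝ → X}
    (hg : g ∈ planeCharts B) (hh : h ∈ planeCharts B) (h0 : g 0 = h 0)
    (hS : g '' closedCell (1, 1) = h '' closedCell (1, 1)) :
    axis h = axis g ∨ axis h = axis fun z => g (0 + coordFlip z) := by
  have key : ∀ t, 0 < t → g (t, 0) = h (t, 0) ∨ g (0, t) = h (t, 0) := by
    intro t ht
    obtain ⟨u, hu, hu'⟩ : h (t, 0) ∈ g '' closedCell (1, 1) := by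
      rw [hS]; exact ⟨_, mem_closedCell_one_one.2 ⟨ht.le, le_rfl⟩, rfl⟩
    obtain ⟨v, hv, hv'⟩ : h (0, t) ∈ g '' closedCell (1, 1) := by
      rw [hS]; exact ⟨_, mem_closedCell_one_one.2 ⟨le_rfl, ht.le⟩, rfl⟩
    have e1 := planeNorm_sub_eq_of_apply_eq hB hg hh hu' h0
    have e2 := planeNorm_sub_eq_of_apply_eq hB hg hh hv' h0
    have e3 := planeNorm_sub_eq_of_apply_eq hB hg hh hu' hv'
    rw [sub_zero, sub_zero] at e1 e2
    rw [planeNorm_axis] at e1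
    have e4 : planeNorm ((t, 0) - (0, t)) = planeNorm (0, t) :=
      planeNorm_eq_iff.2 (by simp only [Prod.fst_sub, Prod.snd_sub]; ring)
    rcases quadrant_corner ht hu hv e1 e2 (e3.trans e4) with rfl | rfl
    · exact Or.inl hu'
    · exact Or.inr hu'
  by_cases hall : ∀ t, 0 < t → g (t, 0) = h (t, 0)
  · left
    refine Set.image_congr fun t ht => ?_
    rcases (show (0 : ℝ) ≤ t from ht).eq_or_lt with rfl | ht
    · exact h0.symm
    · exact (hall t ht).symm
  · right
    push Not at hall
    obtain ⟨a, ha, hne⟩ := hall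
    have hga := (key a ha).resolve_left hne
    refine Set.image_congr fun t ht => ?_
    simp only [zero_add, flip_apply]
    rcases (show (0 : ℝ) ≤ t from ht).eq_or_lt with rfl | ht
    · exact h0.symm
    -- The alternative cannot depend on `t`: at the smaller of two parameters both cases would hold,
    -- against injectivity of `g`.
    · rcases key t ht with h1 | h1
      · exfalso
        have hm : 0 < min a t := lt_min ha ht
        have c1 := apply_axis_eq_of_le hB hg hh h0 (v := (1, 0)) (v' := (1, 0)) hm.le
          (min_le_right _ _) ht (by rwa [smul_one_zero])
        have c2 := apply_axis_eq_of_le hB hg hh h0 (v := (0, 1)) (v' := (1, 0)) hm.le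
          (min_le_left _ _) ha (by rwa [smul_one_zero, smul_zero_one])
        have := hg.2.injective (c1.trans c2.symm)
        rw [smul_one_zero, smul_zero_one, Prod.mk.injEq] at this
        exact hm.ne' this.1
      · exact h1.symm

/-! ### Sectors sharing a face -/

/-- A point of the ray is determined by its distance to the origin, so equal rays have equal
parametrisations. -/
theorem apply_axis_eq (hB : IsAffineBuilding weylA2 B) {g h : ℝ × ℝ → X}
    (hg : g ∈ planeCharts B) (hh : h ∈ planeCharts B) (h0 : g 0 = h 0) (hP : axis g = axis h)
    {t : ℝ} (ht : 0 ≤ t) : g (t, 0) = h (t, 0) := by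
  obtain ⟨s, hs, hst⟩ : g (t, 0) ∈ axis h := hP ▸ ⟨t, ht, rfl⟩
  have hs : 0 ≤ s := hs
  have := planeNorm_sub_eq_of_apply_eq hB hg hh hst.symm h0
  rw [sub_zero, sub_zero, planeNorm_eq_iff] at this
  have : t = s := by nlinarith
  rw [← hst, this]

/-- Two sectors which meet only in a common face have no further common germ. -/
theorem apply_ne_of_inter_subset (hB : IsAffineBuilding weylA2 B) {g h : ℝ × ℝ → X}
    (hg : g ∈ planeCharts B) (hh : h ∈ planeCharts B) (h1 : ∀ t, 0 ≤ t → g (0, t) = h (t, 0))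
    (h2 : g '' closedCell (1, 1) ∩ h '' closedCell (1, 1) ⊆ axis h) {t : ℝ} (ht : 0 < t) :
    g (t, 0) ≠ h (0, t) := by
  intro he
  -- If the other edges also met at parameter `t`, the midpoint of the resulting segment would be
  -- common to both sectors, yet interior to the sector of `h`.
  have hs := apply_segment_eq hB hg hh he (h1 t ht.le) (r := 1 / 2) (by norm_num) (by norm_num)
  have m : ∀ u v : ℝ × ℝ, u ∈ closedCell (1, 1) → v ∈ closedCell (1, 1) →
      u + (1 / 2 : ℝ) • (v - u) ∈ closedCell (1, 1) := by
    intro u v hu hv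
    rw [mem_closedCell_one_one] at hu hv ⊢
    simp
    constructor <;> linarith
  have ma : (t, (0 : ℝ)) ∈ closedCell (1, 1) := mem_closedCell_one_one.2 ⟨ht.le, le_rfl⟩
  have mb : ((0 : ℝ), t) ∈ closedCell (1, 1) := mem_closedCell_one_one.2 ⟨le_rfl, ht.le⟩
  obtain ⟨s, -, hs'⟩ := h2 ⟨⟨_, m _ _ ma mb, hs⟩, ⟨_, m _ _ mb ma, rfl⟩⟩
  have := congrArg Prod.snd (hh.2.injective hs')
  simp at this
  linarith

/-- Each point of the quadrant lies on the segment joining the points of the two half axes with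
parameter `z.1 + z.2`, so convexity suffices. -/
theorem image_quadrant_subset_range (hB : IsAffineBuilding weylA2 B) {g h : ℝ × ℝ → X}
    (hg : g ∈ planeCharts B) (hh : h ∈ planeCharts B)
    (h1 : ∀ t, 0 ≤ t → g (t, 0) ∈ Set.range h) (h2 : ∀ t, 0 ≤ t → g (0, t) ∈ Set.range h) :
    g '' closedCell (1, 1) ⊆ Set.range h := by
  rintro _ ⟨z, hz, rfl⟩
  rw [mem_closedCell_one_one] at hz
  rcases (add_nonneg hz.1 hz.2).eq_or_lt with h0 | h0
  · have : z = (0, 0) := Prod.ext (by simp; linarith) (by simp; linarith)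
    rw [this]
    exact h1 0 le_rfl
  · refine segment_mem_range hB hg hh (u := (z.1 + z.2, 0)) (v := (0, z.1 + z.2))
      (r := z.2 / (z.1 + z.2)) (by have := hz.2; positivity)
      ((div_le_one h0).2 (by linarith)) ?_ (h1 _ h0.le) (h2 _ h0.le)
    ext
    · simp
      field_simp
      ring
    · simp [h0.ne']

/-- If two sectors meet exactly in a common face, an apartment containing the two other faces
contains this face. -/
theorem apply_axis_mem_range (hB : IsAffineBuilding weylA2 B) {g h F : ℝ × ℝ → X}
    (hg : g ∈ planeCharts B) (hh : h ∈ planeCharts B) (hF : F ∈ planeCharts B)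
    (h1 : ∀ t, 0 ≤ t → g (0, t) = h (t, 0))
    (h2 : g '' closedCell (1, 1) ∩ h '' closedCell (1, 1) ⊆ axis h)
    (h3 : ∀ t, 0 ≤ t → g (t, 0) ∈ Set.range F) (h4 : ∀ t, 0 ≤ t → h (0, t) ∈ Set.range F)
    {t : ℝ} (ht : 0 < t) : g (0, t) ∈ Set.range F := by
  -- Four consecutive chambers around `g (0, t)`, two in each sector. The rotations are chosen so
  -- that the points `(t, t)` of the first and last are `g (2 * t, 0)` and `h (0, 2 * t)`, on the
  -- outer faces; their midpoint is `g (0, t)`.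
  have c1 := mem_planeCharts_comp hg isPlaneSymm_rot.symm (0, t)
  have c2 := mem_planeCharts_comp hg isPlaneSymm_refl (0, t)
  have c3 := mem_planeCharts_comp hh isPlaneSymm_refl (t, 0)
  have c4 := mem_planeCharts_comp hh isPlaneSymm_rot (t, 0)
  obtain ⟨k, hk, k1, k4⟩ := exists_opposite hB c1 c2 c3 c4
    (fun s hs => by simp) (fun s hs => by simpa using h1 (t + s) (by positivity))
    (fun s hs => by simp)
    (fun s hs he => by
      have := congrArg Prod.fst (hg.2.injective he)
      simp at this
      exact hs.ne' this)
    (fun s hs he => by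
      simp only [LinearEquiv.refl_apply, Prod.mk_add_mk, zero_add, add_zero] at he
      obtain ⟨r, -, hr⟩ := h2 ⟨⟨(s, t), mem_closedCell_one_one.2 ⟨hs.le, ht.le⟩, rfl⟩,
        ⟨(t, s), mem_closedCell_one_one.2 ⟨ht.le, hs.le⟩, he.symm⟩⟩
      have := congrArg Prod.snd (hh.2.injective (hr.trans he))
      exact hs.ne this)
    (fun s hs he => by
      have := congrArg Prod.snd (hh.2.injective he)
      simp at this
      exact hs.ne this)
  obtain ⟨u, hu⟩ := h3 (2 * t) (by positivity)
  obtain ⟨v, hv⟩ := h4 (2 * t) (by positivity)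
  have := middle_eq_of_opposite hB hk c1 c4 k1 k4 ht ht hF (u := u) (v := v)
    (by rw [hu]; congr 1; ext <;> simp; ring) (by rw [hv]; congr 1; ext <;> simp; ring)
  refine ⟨_, this.symm.trans ?_⟩
  simp

end AffBuilding

/-! ### The apartment containing the four sectors -/

theorem mainTheorem12 {X : Type*} (B : AffBuilding.BuildingData X)
    (hB : AffBuilding.IsAffineBuilding AffBuilding.weylA2 B)
    (hcomplete : AffBuilding.HasCompleteApartments AffBuilding.weylA2 B)
    (x : X) (S : Fin 4 → Set X) (P : Fin 3 → Set X)
    (hS : ∀ i : Fin 4, AffBuilding.IsSectorAt AffBuilding.weylA2 B x (S i))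
    (hP : ∀ i : Fin 3, S i.castSucc ∩ S i.succ = P i)
    (hPl : ∀ i : Fin 3, AffBuilding.IsFaceOfSectorAt AffBuilding.weylA2 B x (S i.castSucc) (P i))
    (hPr : ∀ i : Fin 3, AffBuilding.IsFaceOfSectorAt AffBuilding.weylA2 B x (S i.succ) (P i))
    (h01 : P 0 ≠ P 1) (h12 : P 1 ≠ P 2) :
    ∃ A ∈ B.apartments, ∀ i : Fin 4, S i ⊆ A := by
  open AffBuilding in
  have e1 : S 0 ∩ S 1 = P 0 := hP 0
  have e2 : S 1 ∩ S 2 = P 1 := hP 1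
  have e3 : S 2 ∩ S 3 = P 2 := hP 2
  obtain ⟨f₁, hf₁, f₁x, S₁, P₁⟩ := exists_chart_of_isFaceOfSectorAt
    (show IsFaceOfSectorAt weylA2 B x (S 0) (P 0) from hPl 0)
  obtain ⟨g₂, hg₂, g₂x, S₂, P₂⟩ := exists_chart_of_isFaceOfSectorAt
    (show IsFaceOfSectorAt weylA2 B x (S 1) (P 0) from hPr 0)
  obtain ⟨f₂, hf₂, f₂x, S₂', P₂'⟩ := exists_chart_of_isFaceOfSectorAt
    (show IsFaceOfSectorAt weylA2 B x (S 1) (P 1) from hPl 1)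
  obtain ⟨g₃, hg₃, g₃x, S₃, P₃⟩ := exists_chart_of_isFaceOfSectorAt
    (show IsFaceOfSectorAt weylA2 B x (S 2) (P 1) from hPr 1)
  obtain ⟨f₃, hf₃, f₃x, S₃', P₃'⟩ := exists_chart_of_isFaceOfSectorAt
    (show IsFaceOfSectorAt weylA2 B x (S 2) (P 2) from hPl 2)
  obtain ⟨g₄, hg₄, g₄x, S₄, P₄⟩ := exists_chart_of_isFaceOfSectorAt
    (show IsFaceOfSectorAt weylA2 B x (S 3) (P 2) from hPr 2)
  have hflip : ∀ {g : ℝ × ℝ → X}, g ∈ planeCharts B →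
      (fun z => g (0 + coordFlip z)) ∈ planeCharts B :=
    fun hg => mem_planeCharts_comp hg isPlaneSymm_flip 0
  have hflip0 : ∀ (g : ℝ × ℝ → X), (fun z => g (0 + coordFlip z)) 0 = g 0 := fun g =>
    congrArg g (by simp)
  -- In the chart whose first half axis is `P 0`, the distinct face `P 1` can only be the second
  -- half axis.
  have a2 : P 1 = axis fun z => g₂ (0 + coordFlip z) := by
    rw [P₂']
    refine (axis_eq_or_eq hB hg₂ hf₂ (g₂x.trans f₂x.symm) (S₂.symm.trans S₂')).resolve_left ?_
    rw [← P₂', ← P₂]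
    exact h01.symm
  have a3 : P 2 = axis fun z => g₃ (0 + coordFlip z) := by
    rw [P₃']
    refine (axis_eq_or_eq hB hg₃ hf₃ (g₃x.trans f₃x.symm) (S₃.symm.trans S₃')).resolve_left ?_
    rw [← P₃', ← P₃]
    exact h12.symm
  -- Flipped so that `P 0` is the second half axis of the first sector, as `exists_opposite`
  -- requires.
  obtain ⟨g₁, hg₁'⟩ : ∃ g₁ : ℝ × ℝ → X, g₁ = fun z => f₁ (0 + coordFlip z) := ⟨_, rfl⟩
  have hg₁ : g₁ ∈ planeCharts B := hg₁' ▸ hflip hf₁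
  have S₁' : S 0 = g₁ '' closedCell (1, 1) := by
    have h : coordFlip '' closedCell (1, 1) = closedCell (1, 1) :=
      isPlaneSymm_flip.image_closedCell (1, 1)
    rw [S₁, hg₁', ← h, Set.image_image, h]
    simp only [zero_add]
  have p12 : ∀ t, 0 ≤ t → g₁ (0, t) = g₂ (t, 0) := fun t ht => by
    rw [hg₁']
    simpa using apply_axis_eq hB hf₁ hg₂ (f₁x.trans g₂x.symm) (P₁.symm.trans P₂) ht
  have p23 : ∀ t, 0 ≤ t → g₂ (0, t) = g₃ (t, 0) := fun t ht => by
    simpa using apply_axis_eq hB (hflip hg₂) hg₃ ((hflip0 g₂).trans (g₂x.trans g₃x.symm))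
      (a2.symm.trans P₃) ht
  have p34 : ∀ t, 0 ≤ t → g₃ (0, t) = g₄ (t, 0) := fun t ht => by
    simpa using apply_axis_eq hB (hflip hg₃) hg₄ ((hflip0 g₃).trans (g₃x.trans g₄x.symm))
      (a3.symm.trans P₄) ht
  have i12 : g₁ '' closedCell (1, 1) ∩ g₂ '' closedCell (1, 1) ⊆ axis g₂ := by
    rw [← S₁', ← S₂, e1, P₂]
  have i23 : g₂ '' closedCell (1, 1) ∩ g₃ '' closedCell (1, 1) ⊆ axis g₃ := by
    rw [← S₂, ← S₃, e2, P₃]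
  have i34 : g₃ '' closedCell (1, 1) ∩ g₄ '' closedCell (1, 1) ⊆ axis g₄ := by
    rw [← S₃, ← S₄, e3, P₄]
  obtain ⟨k, hk, k1, k4⟩ := exists_opposite hB hg₁ hg₂ hg₃ hg₄ p12 p23 p34
    (fun t ht => apply_ne_of_inter_subset hB hg₁ hg₂ p12 i12 ht)
    (fun t ht => apply_ne_of_inter_subset hB hg₂ hg₃ p23 i23 ht)
    (fun t ht => apply_ne_of_inter_subset hB hg₃ hg₄ p34 i34 ht)
  obtain ⟨f, hf, hfr⟩ := exists_union_chart hB hk hg₁ hg₄ k1 k4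
  have hA := IsLocalChart.range_mem_apartments hB hcomplete hf
  obtain ⟨F', hF'⟩ := hB.exists_chart _ hA
  have hF := hF'.isPlaneChart.mem hA
  obtain ⟨F, hFF'⟩ : ∃ F : ℝ × ℝ → X, F = F' ∘ coordA2 := ⟨_, rfl⟩
  rw [← hFF'] at hF
  have hFr : Set.range F = Set.range f := hFF' ▸ hF'.isPlaneChart.range_eq
  rw [← hFr] at hA hfr
  have r2 : ∀ t, 0 ≤ t → g₂ (t, 0) ∈ Set.range F := fun t ht => by
    rw [← p12 t ht]; exact (hfr 0 t le_rfl ht).1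
  have r3 : ∀ t, 0 ≤ t → g₃ (0, t) ∈ Set.range F := fun t ht => by
    rw [p34 t ht]; exact (hfr t 0 ht le_rfl).2
  -- The outer panels `P 0` and `P 2` belong to the extreme sectors; the panel `P 1` between the
  -- middle sectors is recovered from them.
  have r23 : ∀ t, 0 ≤ t → g₂ (0, t) ∈ Set.range F := fun t ht => by
    rcases ht.eq_or_lt with rfl | ht
    · exact r2 0 le_rfl
    · exact apply_axis_mem_range hB hg₂ hg₃ hF p23 i23 r2 r3 ht
  refine ⟨Set.range F, hA, ?_⟩
  have s0 : S 0 ⊆ Set.range F := by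
    rw [S₁']
    rintro _ ⟨z, hz, rfl⟩
    rw [mem_closedCell_one_one] at hz
    exact (hfr z.1 z.2 hz.1 hz.2).1
  have s1 : S 1 ⊆ Set.range F := S₂ ▸ image_quadrant_subset_range hB hg₂ hF r2 r23
  have s2 : S 2 ⊆ Set.range F := S₃ ▸ image_quadrant_subset_range hB hg₃ hF
    (fun t ht => p23 t ht ▸ r23 t ht) r3
  have s3 : S 3 ⊆ Set.range F := by
    rw [S₄]
    rintro _ ⟨z, hz, rfl⟩
    rw [mem_closedCell_one_one] at hz
    exact (hfr z.1 z.2 hz.1 hz.2).2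
  intro i
  fin_cases i
  · exact s0
  · exact s1
  · exact s2
  · exact s3
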